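/- Let $F$ be a field of characteristic different from two. A form over a field is a non-degenerate quadratic form on a vector space of finite positive dimension. For a form $q$ over $F$ and a field extension $K/F$, write $q_K$ for $q$ regarded as a form over $K$. A form is hyperbolic if it is isometric to an orthogonal sum of copies of $\langle 1,-1\rangle$, and isotropic if it represents zero non-trivially. For a form $q$ over $F$ and a field extension $K/F$, let $$G_K(q)=\{a\in K^{\times}\mid a\,q_K\simeq q_K\},\qquad H_K(q)=\{a\in K^{\times}\mid \langle 1,-a\rangle\otimes q_K\text{ is isotropic over }K\}.$$ For a form $p$ over $F$ with $\dim p=n\geqslant 2$ and $p\not\simeq\langle 1,-1\rangle$, let $F(p)$ be the quotient field of the integral domain $F[X_1,\ldots,X_n]/(p(X_1,\ldots,X_n))$; if $\dim p=1$ or $p\simeq\langle 1,-1\rangle$, set $F(p)=F$. **Corollary.** Let $p$ and $q$ be forms over $F$ (either may be isotropic). If $q$ is hyperbolic over $F(p)$, that is, if $q_{F(p)}$ is hyperbolic, then $H_K(p)\subseteq G_K(q)$ for every field extension $K/F$. -/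

import Mathlib

open scoped TensorProduct

noncomputable section

namespace QuadraticForm

section Basic

variable {K : Type*} [Field K]

/-- The hyperbolic plane `⟨1, -1⟩` over `K`. -/
def hyperbolicPlane (K : Type*) [Field K] : QuadraticForm K (Fin 2 → K) :=
  QuadraticMap.weightedSumSquares K ![(1 : K), -1]

variable {V : Type*} [AddCommGroup V] [Module K V]

/-- A form is hyperbolic if it is isometric to an orthogonal sum `n × ⟨1, -1⟩` of hyperbolic
planes, that is, if its anisotropic part is zero and its Witt index is half its dimension. -/
def IsHyperbolic (q : QuadraticForm K V) : Prop :=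
  ∃ n : ℕ, QuadraticMap.Equivalent q (QuadraticMap.pi fun _ : Fin n => hyperbolicPlane K)

/-- A form is isotropic if it represents zero non-trivially. -/
def IsIsotropic (q : QuadraticForm K V) : Prop :=
  ∃ v : V, v ≠ 0 ∧ q v = 0

/-- `G_K(q)`, the set of similarity factors of `q`: the `a ∈ Kˣ` with `a q ≃ q`. -/
def similarityFactors (q : QuadraticForm K V) : Set Kˣ :=
  {a | QuadraticMap.Equivalent ((a : K) • q) q}

/-- `H_K(q)`, the set of `a ∈ Kˣ` such that `⟨1, -a⟩ ⊗ q` is isotropic over `K`. -/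
def isotropyFactors [Invertible (2 : K)] (q : QuadraticForm K V) : Set Kˣ :=
  {a | IsIsotropic (QuadraticForm.tmul
    (QuadraticMap.weightedSumSquares K ![(1 : K), -(a : K)]) q)}

end Basic

section FunctionField

variable {F : Type*} [Field F] [Invertible (2 : F)]
variable {V : Type*} [AddCommGroup V] [Module F V]

/-- The homogeneous quadratic polynomial `p(X₁, …, Xₙ)` that expresses `p` in the coordinates of
the basis `b`. -/
def polynomial {ι : Type*} [Fintype ι] (p : QuadraticForm F V) (b : Module.Basis ι F V) :
    MvPolynomial ι F :=
  ∑ i, ∑ j, MvPolynomial.C (QuadraticMap.associated p (b i) (b j)) *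
    (MvPolynomial.X i * MvPolynomial.X j)

theorem eval_polynomial {ι : Type*} [Fintype ι] (p : QuadraticForm F V)
    (b : Module.Basis ι F V) (x : ι → F) :
    MvPolynomial.eval x (polynomial p b) = p (∑ i, x i • b i) := by
  rw [← QuadraticMap.associated_eq_self_apply F p]
  simp only [polynomial, map_sum, map_mul, MvPolynomial.eval_C, MvPolynomial.eval_X,
    LinearMap.sum_apply, map_smul, LinearMap.smul_apply, smul_eq_mul, Finset.mul_sum]
  rw [Finset.sum_comm]
  refine Finset.sum_congr rfl fun i _ => Finset.sum_congr rfl fun j _ => ?_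
  ring

theorem isHomogeneous_polynomial {ι : Type*} [Fintype ι] (p : QuadraticForm F V)
    (b : Module.Basis ι F V) : (polynomial p b).IsHomogeneous 2 := by
  refine MvPolynomial.IsHomogeneous.sum _ _ _ fun i _ =>
    MvPolynomial.IsHomogeneous.sum _ _ _ fun j _ => ?_
  exact ((MvPolynomial.isHomogeneous_X F i).mul (MvPolynomial.isHomogeneous_X F j)).C_mul _

/-- A polynomial of total degree at most one is a constant plus a linear form. -/
theorem exists_eq_C_add_linear {F : Type*} [Field F] {ι : Type*} [Fintype ι]
    (A : MvPolynomial ι F)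
    (hA : A.totalDegree ≤ 1) :
    ∃ (a : F) (c : ι → F), A = MvPolynomial.C a + ∑ i, MvPolynomial.C (c i) * MvPolynomial.X i := by
  have h1 : MvPolynomial.homogeneousComponent 1 A ∈ MvPolynomial.homogeneousSubmodule ι F 1 :=
    MvPolynomial.homogeneousComponent_isHomogeneous 1 A
  rw [MvPolynomial.homogeneousSubmodule_one_eq_span_X, Submodule.mem_span_range_iff_exists_fun]
    at h1
  obtain ⟨c, hc⟩ := h1
  refine ⟨MvPolynomial.coeff 0 A, c, ?_⟩
  have h2 : ∑ i ∈ Finset.range 2, MvPolynomial.homogeneousComponent i A = A := by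
    conv_rhs => rw [← MvPolynomial.sum_homogeneousComponent A]
    refine (Finset.sum_subset (Finset.range_subset_range.2 (by omega)) ?_).symm
    intro i _ hi
    exact MvPolynomial.homogeneousComponent_eq_zero _ _ (by simpa using hi)
  rw [Finset.sum_range_succ, Finset.sum_range_one, MvPolynomial.homogeneousComponent_zero,
    ← hc] at h2
  simpa only [MvPolynomial.smul_eq_C_mul] using h2.symm

/-- A product of two linear forms on a space of dimension at least two is either degenerate or the
hyperbolic plane. -/
theorem equivalent_hyperbolicPlane_of_eq_mul [FiniteDimensional F V] {p : QuadraticForm F V}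
    (hp : p.Nondegenerate) (hn : 2 ≤ Module.finrank F V) (f g : V →ₗ[F] F)
    (h : ∀ v, p v = f v * g v) : QuadraticMap.Equivalent p (hyperbolicPlane F) := by
  have h2 : (2 : F) ≠ 0 := Invertible.ne_zero 2
  let T : V →ₗ[F] (Fin 2 → F) := LinearMap.pi ![(⅟2 : F) • (f + g), (⅟2 : F) • (f - g)]
  have hT0 : ∀ v, T v 0 = ⅟2 * (f v + g v) := fun v => by
    simp [T, mul_add]
  have hT1 : ∀ v, T v 1 = ⅟2 * (f v - g v) := fun v => by simp [T]
  have hinj : Function.Injective T := by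
    rw [← LinearMap.ker_eq_bot, Submodule.eq_bot_iff]
    intro v hv
    have e0 := hT0 v
    have e1 := hT1 v
    rw [LinearMap.mem_ker.1 hv] at e0 e1
    have e0' : f v + g v = 0 := by simpa [h2] using e0
    have e1' : f v - g v = 0 := by simpa [h2] using e1
    have hf : f v = 0 := by
      have : 2 * f v = 0 := by linear_combination e0' + e1'
      simpa [h2] using this
    have hg : g v = 0 := by simpa [hf] using e0'
    have : v ∈ p.radical := by
      rw [QuadraticMap.mem_radical_iff']
      exact ⟨by simp [h, hf], fun n => by simp [h, hf, hg]⟩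
    rw [hp.radical_eq_bot] at this
    simpa using this
  have hfr : Module.finrank F V = Module.finrank F (Fin 2 → F) :=
    le_antisymm (LinearMap.finrank_le_finrank_of_injective hinj) (by simpa using hn)
  refine ⟨⟨LinearEquiv.ofInjectiveOfFinrankEq T hinj hfr, fun v => ?_⟩⟩
  change hyperbolicPlane F (T v) = p v
  rw [hyperbolicPlane, QuadraticMap.weightedSumSquares_apply, Fin.sum_univ_two, hT0, hT1, h]
  simp only [Matrix.cons_val_zero, Matrix.cons_val_one, smul_eq_mul, invOf_eq_inv]
  field_simp
  ring

/-- The polynomial of a nondegenerate form of dimension at least two, other than the hyperbolic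
plane, is irreducible. -/
theorem irreducible_polynomial [FiniteDimensional F V] {p : QuadraticForm F V}
    (hp : p.Nondegenerate) (hn : 2 ≤ Module.finrank F V)
    (hH : ¬ QuadraticMap.Equivalent p (hyperbolicPlane F))
    {ι : Type*} [Fintype ι] (b : Module.Basis ι F V) : Irreducible (polynomial p b) := by
  have hev : ∀ v : V, MvPolynomial.eval (b.equivFun v) (polynomial p b) = p v := fun v => by
    rw [eval_polynomial, b.sum_equivFun]
  have hfac : ∀ f g : V →ₗ[F] F, ¬ ∀ v, p v = f v * g v := fun f g h =>
    hH (equivalent_hyperbolicPlane_of_eq_mul hp hn f g h)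
  have hne : polynomial p b ≠ 0 := fun h0 => hfac 0 0 fun v => by rw [← hev, h0]; simp
  have hdeg := (isHomogeneous_polynomial p b).totalDegree hne
  refine ⟨fun hu => ?_, fun {A B} hAB => ?_⟩
  · rw [MvPolynomial.isUnit_iff_totalDegree_of_isReduced] at hu
    omega
  · have hA0 : A ≠ 0 := by rintro rfl; simp [hAB] at hne
    have hB0 : B ≠ 0 := by rintro rfl; simp [hAB] at hne
    have hsum : A.totalDegree + B.totalDegree = 2 := by
      rw [← MvPolynomial.totalDegree_mul_of_isDomain hA0 hB0, ← hAB, hdeg]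
    have hunit : ∀ {C : MvPolynomial ι F}, C ≠ 0 → C.totalDegree = 0 → IsUnit C := by
      intro C hC h0
      rw [MvPolynomial.totalDegree_eq_zero_iff_eq_C] at h0
      rw [h0] at hC ⊢
      exact (IsUnit.mk0 _ fun h => hC (by rw [h, map_zero])).map MvPolynomial.C
    by_cases hA : A.totalDegree = 0
    · exact Or.inl (hunit hA0 hA)
    by_cases hB : B.totalDegree = 0
    · exact Or.inr (hunit hB0 hB)
    exfalso
    obtain ⟨a, c, hc⟩ := exists_eq_C_add_linear A (by omega)
    obtain ⟨a', c', hc'⟩ := exists_eq_C_add_linear B (by omega)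
    set L : MvPolynomial ι F := ∑ i, MvPolynomial.C (c i) * MvPolynomial.X i with hL
    set L' : MvPolynomial ι F := ∑ i, MvPolynomial.C (c' i) * MvPolynomial.X i with hL'
    have hLh : L.IsHomogeneous 1 := MvPolynomial.IsHomogeneous.sum _ _ _ fun i _ =>
      MvPolynomial.isHomogeneous_C_mul_X _ _
    have hLh' : L'.IsHomogeneous 1 := MvPolynomial.IsHomogeneous.sum _ _ _ fun i _ =>
      MvPolynomial.isHomogeneous_C_mul_X _ _
    have hPL : polynomial p b = L * L' := by
      have e : polynomial p b =
          MvPolynomial.C (a * a') + (MvPolynomial.C a * L' + MvPolynomial.C a' * L) + L * L' := by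
        rw [hAB, hc, hc', map_mul]; ring
      have e' := congrArg (MvPolynomial.homogeneousComponent 2) e
      rw [map_add, map_add,
        MvPolynomial.homogeneousComponent_of_mem (isHomogeneous_polynomial p b),
        MvPolynomial.homogeneousComponent_of_mem (MvPolynomial.isHomogeneous_C ι (a * a')),
        MvPolynomial.homogeneousComponent_of_mem ((hLh'.C_mul a).add (hLh.C_mul a')),
        MvPolynomial.homogeneousComponent_of_mem (hLh.mul hLh')] at e'
      simpa using e'
    have hlin : ∀ c : ι → F, ∃ f : V →ₗ[F] F, ∀ v, f v = MvPolynomial.eval (b.equivFun v)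
        (∑ i, MvPolynomial.C (c i) * MvPolynomial.X i) := fun c =>
      ⟨∑ i, c i • b.coord i, fun v => by simp⟩
    obtain ⟨f, hf⟩ := hlin c
    obtain ⟨g, hg⟩ := hlin c'
    exact hfac f g fun v => by rw [← hev, hPL, map_mul, hf, hg]

variable [FiniteDimensional F V] [Nontrivial V]

open Classical in
/-- The prime ideal of `F[X₁, …, Xₙ]` that defines `F(p)`: the ideal generated by
`p(X₁, …, Xₙ)`, except that for `dim p = 1` and for `p ≃ ⟨1, -1⟩` it is the ideal of the origin,
whose residue ring is `F`. -/
def functionFieldIdeal (p : QuadraticForm F V) (_hp : p.Nondegenerate) :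
    Ideal (MvPolynomial (Fin (Module.finrank F V)) F) :=
  if Module.finrank F V = 1 ∨ QuadraticMap.Equivalent p (hyperbolicPlane F) then
    RingHom.ker (MvPolynomial.constantCoeff (R := F) (σ := Fin (Module.finrank F V)))
  else
    Ideal.span {polynomial p (Module.finBasis F V)}

instance (p : QuadraticForm F V) (hp : p.Nondegenerate) : (functionFieldIdeal p hp).IsPrime := by
  unfold functionFieldIdeal
  split_ifs with h
  · exact RingHom.ker_isPrime _
  · rw [not_or] at h
    have hpos : 0 < Module.finrank F V := Module.finrank_pos
    have hirr := irreducible_polynomial hp (by omega) h.2 (Module.finBasis F V)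
    exact (Ideal.span_singleton_prime hirr.ne_zero).2 hirr.prime

/-- The function field `F(p)` of a form `p`: the quotient field of the integral domain
`F[X₁, …, Xₙ] / (p(X₁, …, Xₙ))` if `dim p ≥ 2` and `p` is not the hyperbolic plane, and (a copy of)
`F` itself if `dim p = 1` or `p ≃ ⟨1, -1⟩`. -/
abbrev FunctionField (p : QuadraticForm F V) (hp : p.Nondegenerate) : Type _ :=
  FractionRing (MvPolynomial (Fin (Module.finrank F V)) F ⧸ functionFieldIdeal p hp)

/-- In the two exceptional cases the function field is `F`. -/
theorem bijective_algebraMap_functionField (p : QuadraticForm F V) (hp : p.Nondegenerate)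
    (h : Module.finrank F V = 1 ∨ QuadraticMap.Equivalent p (hyperbolicPlane F)) :
    Function.Bijective (algebraMap F (FunctionField p hp)) := by
  let A := MvPolynomial (Fin (Module.finrank F V)) F ⧸ functionFieldIdeal p hp
  have hs : Function.Surjective (algebraMap F A) := by
    intro x
    obtain ⟨P, rfl⟩ := Ideal.Quotient.mk_surjective x
    refine ⟨MvPolynomial.constantCoeff P, ?_⟩
    change Ideal.Quotient.mk _ (MvPolynomial.C _) = _
    rw [Ideal.Quotient.eq, functionFieldIdeal, if_pos h, RingHom.mem_ker]
    simp
  have hb : Function.Bijective (algebraMap F A) := ⟨(algebraMap F A).injective, hs⟩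
  have hA : IsField A := (RingEquiv.ofBijective _ hb).symm.toMulEquiv.isField (Field.toIsField F)
  rw [IsScalarTower.algebraMap_eq F A (FunctionField p hp)]
  let := hA.toField
  have hA' : Function.Bijective (algebraMap A (FunctionField p hp)) :=
    ⟨IsFractionRing.injective A _, IsFractionRing.surjective_iff_isField.2 hA⟩
  exact hA'.comp hb

end FunctionField

end QuadraticForm

end

open scoped TensorProduct

noncomputable section

open QuadraticMap Module

namespace QuadraticForm

-- Let `a` lie in `H_K(p)`, so that `p v = a * p w` with `v`, `w` not both zero. On the line `v + t
-- w` the form `p` becomes `s t² + 2βt + a s` with `s = p w`, whose discriminant is `4δ`, `δ = β² -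
-- a s²`. If `s ≠ 0` and `δ` is not a square, then `p` is isotropic over `E = K(√δ)` and `a = (β/s)²
-- - δ (1/s)²` is a norm from `E`. In the remaining cases `p` is isotropic over `K` or `a` is a
-- square. This is `equivalent_smul_self_of_isotropic_imp`.
--
-- Two facts finish the argument. First, `q` becomes hyperbolic over every extension `L` of `F` over
-- which `p` is isotropic (`HasLagrangian.of_functionField`). Outside the exceptional cases,
-- reflecting a rational zero of `p` in a generic vector produces a generic point of the quadric
-- over an iterated rational function field `M` over `L`. This embeds `F(p)` in `M`, and
-- hyperbolicity then descends from `M` to `L` by setting the variables to zero. Second, norms from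
-- `E` are similarity factors of a form that is hyperbolic over `E`, because the form splits into
-- binary pieces `⟨c, -cδ⟩` and `⟨c, -c⟩` (`equivalent_smul_self_of_hasLagrangian_quadratic`).
--
-- Hyperbolicity is handled through `HasLagrangian`: for nondegenerate forms it is equivalent, and
-- dimension counts carry it along specializations and to complements of split planes without Witt
-- cancellation.

universe u v

/-! ### Totally isotropic subspaces of half dimension -/

section Lagrangian

variable {K : Type*} [Field K] {V : Type*} [AddCommGroup V] [Module K V]
  {W : Type*} [AddCommGroup W] [Module K W]

/-- A form has a Lagrangian if it has a totally isotropic subspace of at least half the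
dimension. -/
def HasLagrangian (q : QuadraticForm K V) : Prop :=
  ∃ U : Submodule K V, (∀ x ∈ U, q x = 0) ∧ finrank K V ≤ 2 * finrank K U

theorem HasLagrangian.of_equivalent {q : QuadraticForm K V} {q' : QuadraticForm K W}
    (h : HasLagrangian q) (e : q.Equivalent q') : HasLagrangian q' := by
  obtain ⟨U, hU, hd⟩ := h
  obtain ⟨e⟩ := e
  refine ⟨U.map (e.toLinearEquiv : V →ₗ[K] W), ?_, ?_⟩
  · rintro _ ⟨x, hx, rfl⟩
    exact (e.map_app x).trans (hU x hx)
  · rw [LinearEquiv.finrank_map_eq, ← e.toLinearEquiv.finrank_eq]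
    exact hd

/-- In each plane `⟨1, -1⟩` the diagonal line is isotropic; the sum of these lines has half the
dimension. -/
theorem IsHyperbolic.hasLagrangian {q : QuadraticForm K V} (h : IsHyperbolic q) :
    HasLagrangian q := by
  obtain ⟨n, hn⟩ := h
  refine HasLagrangian.of_equivalent ?_ hn.symm
  let T : (Fin n → K) →ₗ[K] (Fin n → Fin 2 → K) :=
    LinearMap.pi fun i => LinearMap.pi fun _ => LinearMap.proj i
  have hT : Function.Injective T := fun x y hxy => funext fun i => congrFun (congrFun hxy i) 0
  refine ⟨LinearMap.range T, ?_, ?_⟩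
  · rintro _ ⟨x, rfl⟩
    rw [QuadraticMap.pi_apply]
    refine Finset.sum_eq_zero fun i _ => ?_
    simp [hyperbolicPlane, T]
  · rw [LinearMap.finrank_range_of_inj hT, Module.finrank_pi_fintype]
    simp [mul_comm]

theorem finrank_map_add_finrank_inf_ker [FiniteDimensional K V] (g : V →ₗ[K] W)
    (U : Submodule K V) :
    finrank K (U.map g) + finrank K ↥(U ⊓ LinearMap.ker g) = finrank K U := by
  rw [← LinearMap.finrank_range_add_finrank_ker (g.domRestrict U), LinearMap.range_domRestrict,
    LinearMap.ker_domRestrict, ← Submodule.map_comap_subtype, Submodule.finrank_map_subtype_eq]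

theorem finrank_le_finrank_inf_ker_add_one [FiniteDimensional K V] (f : V →ₗ[K] K)
    (U : Submodule K V) : finrank K U ≤ finrank K ↥(U ⊓ LinearMap.ker f) + 1 := by
  have h := finrank_map_add_finrank_inf_ker f U
  have h1 : finrank K (U.map f) ≤ 1 := by simpa using Submodule.finrank_le (U.map f)
  omega

/-- A Lagrangian of `⟨c, -c r²⟩ ⊥ Q` induces a Lagrangian of `Q`. -/
theorem HasLagrangian.of_prod [FiniteDimensional K V] {Q : QuadraticForm K V} {c r : K}
    (h2 : (2 : K) ≠ 0) (hc : c ≠ 0) (hr : r ≠ 0)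
    (h : HasLagrangian ((weightedSumSquares K ![c, -c * r ^ 2]).prod Q)) : HasLagrangian Q := by
  set P : QuadraticForm K ((Fin 2 → K) × V) :=
    (weightedSumSquares K ![c, -c * r ^ 2]).prod Q with hP
  obtain ⟨U, hU, hd⟩ : ∃ U : Submodule K ((Fin 2 → K) × V), (∀ x ∈ U, P x = 0) ∧
    finrank K ((Fin 2 → K) × V) ≤ 2 * finrank K U := h
  have hPa : ∀ z : (Fin 2 → K) × V, P z = c * (z.1 0 ^ 2 - r ^ 2 * z.1 1 ^ 2) + Q z.2 := by
    intro z
    simp [hP, Fin.sum_univ_two]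
    ring
  -- Up to the factor `2cr`, `f` is the polar pairing with the isotropic vector `z₀` below. The new
  -- Lagrangian is the image of `U ∩ z₀^⊥` in `z₀^⊥ / z₀`, identified with `V`.
  let f : ((Fin 2 → K) × V) →ₗ[K] K :=
    (LinearMap.proj 0 - r • LinearMap.proj 1) ∘ₗ LinearMap.fst K _ _
  have hf : ∀ z, f z = z.1 0 - r * z.1 1 := fun z => by simp [f]
  let z₀ : (Fin 2 → K) × V := (![r, 1], 0)
  have hdim : finrank K ((Fin 2 → K) × V) = 2 + finrank K V := by simp
  rw [hdim] at hd
  have hker : (U ⊓ LinearMap.ker f) ⊓ LinearMap.ker (LinearMap.snd K (Fin 2 → K) V) ≤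
      Submodule.span K {z₀} := by
    rintro z ⟨⟨-, hz⟩, hz2⟩
    have hz' := hf z
    rw [LinearMap.mem_ker.1 hz] at hz'
    rw [Submodule.mem_span_singleton]
    refine ⟨z.1 1, Prod.ext (funext fun i => ?_) ?_⟩
    · fin_cases i
      · simp [z₀]
        linear_combination hz'
      · simp [z₀]
    · simpa [z₀] using (LinearMap.mem_ker.1 hz2).symm
  refine ⟨(U ⊓ LinearMap.ker f).map (LinearMap.snd K (Fin 2 → K) V), ?_, ?_⟩
  · rintro _ ⟨z, ⟨hz, hzf⟩, rfl⟩
    have h1 := hPa z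
    have h2 := hf z
    rw [hU z hz] at h1
    rw [LinearMap.mem_ker.1 hzf] at h2
    rw [LinearMap.snd_apply]
    linear_combination -h1 - c * (z.1 0 + r * z.1 1) * (-h2)
  · have e1 := finrank_map_add_finrank_inf_ker (LinearMap.snd K (Fin 2 → K) V)
      (U ⊓ LinearMap.ker f)
    have e2 := finrank_le_finrank_inf_ker_add_one f U
    -- Only one dimension may be lost. If `z₀ ∈ U`, then `U` already lies in `z₀^⊥` and the
    -- projection kills one line; otherwise intersecting with `z₀^⊥` costs at most one and the
    -- projection is injective.
    by_cases hz₀ : z₀ ∈ U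
    · have hUf : U ⊓ LinearMap.ker f = U := by
        refine inf_eq_left.2 fun z hz => ?_
        have h1 := hPa (z + z₀)
        have h3 := hPa z
        rw [hU _ (U.add_mem hz hz₀)] at h1
        rw [hU _ hz] at h3
        have h4 : 2 * c * r * f z = 0 := by
          rw [hf]
          simp [z₀] at h1
          linear_combination -h1 + h3
        simpa [h2, hc, hr] using h4
      have e3 := (Submodule.finrank_mono hker).trans (finrank_span_le_card {z₀})
      simp only [Set.toFinset_singleton, Finset.card_singleton] at e3
      rw [hUf] at e1 e3 ⊢
      omega
    · have hb : (U ⊓ LinearMap.ker f) ⊓ LinearMap.ker (LinearMap.snd K (Fin 2 → K) V) = ⊥ := by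
        rw [Submodule.eq_bot_iff]
        intro z hz
        obtain ⟨t, rfl⟩ := Submodule.mem_span_singleton.1 (hker hz)
        by_contra hne
        have ht : t ≠ 0 := fun h => hne (by rw [h, zero_smul])
        exact hz₀ ((U.smul_mem_iff ht).1 hz.1.1)
      rw [hb, finrank_bot] at e1
      omega

theorem HasLagrangian.exists_isotropic {q : QuadraticForm K V} (h : HasLagrangian q)
    (hV : 0 < finrank K V) : IsIsotropic q := by
  obtain ⟨U, hU, hd⟩ := h
  have : U ≠ ⊥ := by
    rintro rfl
    simp at hd
    omega
  obtain ⟨v, hv, hv0⟩ := Submodule.exists_mem_ne_zero_of_ne_bot this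
  exact ⟨v, hv0, hU v hv⟩

end Lagrangian

/-! ### Specialization of Lagrangians -/

section Specialization

variable {R E M : Type*} [CommRing R] [Field E] [Algebra R E] [Field M] {ι : Type*} [Fintype ι]

/-- The reduction of a subspace along a place has at least the same dimension. -/
theorem finrank_le_finrank_span_reduction (ψ : R →+* M)
    (hinj : Function.Injective (algebraMap R E))
    (hψ : ∀ u : ι → E, u ≠ 0 → ∃ (l : E) (w : ι → R),
      (∀ i, algebraMap R E (w i) = l * u i) ∧ ∃ i, ψ (w i) ≠ 0)
    (U : Submodule E (ι → E)) :
    finrank E U ≤ finrank M (Submodule.span M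
      {x : ι → M | ∃ w : ι → R, (fun i => algebraMap R E (w i)) ∈ U ∧ x = fun i => ψ (w i)}) := by
  induction hn : finrank E U using Nat.strong_induction_on generalizing U with
  | _ n ih =>
    by_cases hU : U = ⊥
    · subst hU
      simp at hn
      omega
    obtain ⟨u, huU, hu0⟩ := Submodule.exists_mem_ne_zero_of_ne_bot hU
    obtain ⟨l, w, hw, i, hi⟩ := hψ u hu0
    have hwU : (fun i => algebraMap R E (w i)) ∈ U := by
      have : (fun i => algebraMap R E (w i)) = l • u := funext hw
      rw [this]
      exact U.smul_mem l huU
    -- Passing to `U₀` costs at most one dimension, while its reduction lies in the hyperplane `xᵢ =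
    -- 0` and so misses the reduction of `w`.
    set U₀ := U ⊓ LinearMap.ker (LinearMap.proj i : (ι → E) →ₗ[E] E) with hU₀
    have hlt : U₀ < U := by
      refine lt_of_le_of_ne inf_le_left fun h => ?_
      rw [← h] at hwU
      have h0 : algebraMap R E (w i) = 0 := hwU.2
      rw [map_eq_zero_iff _ hinj] at h0
      exact hi (by rw [h0, map_zero])
    have h1 := ih _ (hn ▸ Submodule.finrank_lt_finrank_of_lt hlt) U₀ rfl
    have h2 := finrank_le_finrank_inf_ker_add_one (LinearMap.proj i : (ι → E) →ₗ[E] E) U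
    rw [← hU₀] at h2
    have h3 : Submodule.span M {x : ι → M | ∃ w : ι → R,
          (fun i => algebraMap R E (w i)) ∈ U₀ ∧ x = fun i => ψ (w i)} <
        Submodule.span M {x : ι → M | ∃ w : ι → R,
          (fun i => algebraMap R E (w i)) ∈ U ∧ x = fun i => ψ (w i)} := by
      refine lt_of_le_of_ne (Submodule.span_mono ?_) fun h => ?_
      · rintro _ ⟨w', hw', rfl⟩
        exact ⟨w', hw'.1, rfl⟩
      · have hmem : (fun i => ψ (w i)) ∈ Submodule.span M {x : ι → M | ∃ w : ι → R,
            (fun i => algebraMap R E (w i)) ∈ U₀ ∧ x = fun i => ψ (w i)} := by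
          rw [h]
          exact Submodule.subset_span ⟨w, hwU, rfl⟩
        have hle : Submodule.span M {x : ι → M | ∃ w : ι → R,
            (fun i => algebraMap R E (w i)) ∈ U₀ ∧ x = fun i => ψ (w i)} ≤
            LinearMap.ker (LinearMap.proj i : (ι → M) →ₗ[M] M) := by
          rw [Submodule.span_le]
          rintro _ ⟨w', hw', rfl⟩
          have h0 : algebraMap R E (w' i) = 0 := hw'.2
          rw [map_eq_zero_iff _ hinj] at h0
          simp [h0]
        exact hi (hle hmem)
    have h4 := Submodule.finrank_lt_finrank_of_lt h3
    omega

/-- Lagrangians of diagonal forms specialize along places. -/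
theorem HasLagrangian.specialize {F : Type*} [CommRing F] [Algebra F R] [Algebra F E]
    [IsScalarTower F R E] [Algebra F M] (h2 : (2 : E) ≠ 0) (ψ : R →ₐ[F] M)
    (hinj : Function.Injective (algebraMap R E))
    (hψ : ∀ u : ι → E, u ≠ 0 → ∃ (l : E) (w : ι → R),
      (∀ i, algebraMap R E (w i) = l * u i) ∧ ∃ i, ψ (w i) ≠ 0) {c : ι → F}
    (h : HasLagrangian (weightedSumSquares E fun i => algebraMap F E (c i))) :
    HasLagrangian (weightedSumSquares M fun i => algebraMap F M (c i)) := by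
  obtain ⟨U, hU, hd⟩ := h
  have hd' := finrank_le_finrank_span_reduction (ψ : R →+* M) hinj hψ U
  refine ⟨_, fun x hx => ?_, le_trans ?_ (Nat.mul_le_mul_left 2 hd')⟩
  swap
  · simpa using hd
  -- Vanishing of a quadratic form on generators does not pass to their span, so the bilinear form
  -- is shown to vanish on pairs of generators.
  have hgen : ∀ w w' : ι → R, (fun i => algebraMap R E (w i)) ∈ U →
      (fun i => algebraMap R E (w' i)) ∈ U →
      ∑ i, algebraMap F M (c i) * (ψ (w i) * ψ (w' i)) = 0 := by
    intro w w' hw hw'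
    have h1 := hU _ hw
    have h1' := hU _ hw'
    have h3 := hU _ (U.add_mem hw hw')
    simp only [weightedSumSquares_apply, smul_eq_mul, Pi.add_apply] at h1 h1' h3
    have h4 : (2 : E) * algebraMap R E (∑ i, algebraMap F R (c i) * (w i * w' i)) = 0 := by
      have h5 : ∑ i, algebraMap F E (c i) * ((algebraMap R E (w i) + algebraMap R E (w' i)) *
            (algebraMap R E (w i) + algebraMap R E (w' i))) -
          ∑ i, algebraMap F E (c i) * (algebraMap R E (w i) * algebraMap R E (w i)) -
          ∑ i, algebraMap F E (c i) * (algebraMap R E (w' i) * algebraMap R E (w' i)) = 0 := by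
        rw [h1, h1', h3]
        simp
      rw [← h5, ← Finset.sum_sub_distrib, ← Finset.sum_sub_distrib, map_sum, Finset.mul_sum]
      refine Finset.sum_congr rfl fun i _ => ?_
      rw [map_mul, map_mul, ← IsScalarTower.algebraMap_apply]
      ring
    have h6 := (map_eq_zero_iff _ hinj).1 ((mul_eq_zero.1 h4).resolve_left h2)
    simpa using congrArg ψ h6
  have key : ∀ x ∈ Submodule.span M {x : ι → M | ∃ w : ι → R,
        (fun i => algebraMap R E (w i)) ∈ U ∧ x = fun i => ψ (w i)},
      ∀ y ∈ Submodule.span M {x : ι → M | ∃ w : ι → R,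
        (fun i => algebraMap R E (w i)) ∈ U ∧ x = fun i => ψ (w i)},
      ∑ i, algebraMap F M (c i) * (x i * y i) = 0 := by
    intro x hx y hy
    induction hx, hy using Submodule.span_induction₂ with
    | mem_mem x y hx hy =>
      obtain ⟨w, hw, rfl⟩ := hx
      obtain ⟨w', hw', rfl⟩ := hy
      exact hgen w w' hw hw'
    | zero_left y hy => simp
    | zero_right x hx => simp
    | add_left x y z _ _ _ h h' => simp [add_mul, mul_add, Finset.sum_add_distrib, h, h']
    | add_right x y z _ _ _ h h' => simp [mul_add, Finset.sum_add_distrib, h, h']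
    | smul_left r x y _ _ h =>
      simp only [Pi.smul_apply, smul_eq_mul]
      rw [← mul_zero r, ← h, Finset.mul_sum]
      exact Finset.sum_congr rfl fun i _ => by ring
    | smul_right r x y _ _ h =>
      simp only [Pi.smul_apply, smul_eq_mul]
      rw [← mul_zero r, ← h, Finset.mul_sum]
      exact Finset.sum_congr rfl fun i _ => by ring
  simpa using key x hx x hx

end Specialization

/-! ### Diagonal forms and orthogonal splitting -/

section Diagonal

theorem equivalent_baseChange_weightedSumSquares {F : Type*} [Field F] [Invertible (2 : F)]
    {V : Type*} [AddCommGroup V] [Module F V] {ι : Type*} [Fintype ι] {q : QuadraticForm F V}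
    {c : ι → F} (h : q.Equivalent (weightedSumSquares F c)) (K : Type*) [Field K] [Algebra F K] :
    (q.baseChange K).Equivalent (weightedSumSquares K fun i => algebraMap F K (c i)) := by
  classical
  obtain ⟨e⟩ := h
  let f : K ⊗[F] V ≃ₗ[K] (ι → K) :=
    (e.toLinearEquiv.baseChange F K V (ι → F)).trans (TensorProduct.piScalarRight F K K ι)
  have hf : ∀ m i, f (1 ⊗ₜ m) i = algebraMap F K (e m i) := by
    intro m i
    simp [f, Algebra.algebraMap_eq_smul_one]
  have key : (weightedSumSquares K fun i => algebraMap F K (c i)).comp (f : K ⊗[F] V →ₗ[K] (ι → K))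
      = q.baseChange K := by
    refine baseChange_ext fun m => ?_
    rw [baseChange_tmul, ← e.map_app m]
    simp only [QuadraticMap.comp_apply, LinearEquiv.coe_coe, weightedSumSquares_apply, hf,
      smul_eq_mul, mul_one, Algebra.smul_def, map_sum, map_mul]
  exact ⟨⟨f, fun m => congrArg (fun Q : QuadraticForm K (K ⊗[F] V) => Q m) key⟩⟩

theorem equivalent_weightedSumSquares_map {F : Type*} [Field F] [Invertible (2 : F)]
    {ι κ : Type*} [Fintype ι] [Fintype κ] {c : ι → F} {d : κ → F}
    (h : (weightedSumSquares F c).Equivalent (weightedSumSquares F d))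
    (K : Type*) [Field K] [Algebra F K] :
    (weightedSumSquares K fun i => algebraMap F K (c i)).Equivalent
      (weightedSumSquares K fun i => algebraMap F K (d i)) :=
  (equivalent_baseChange_weightedSumSquares (Equivalent.refl _) K).symm.trans
    (equivalent_baseChange_weightedSumSquares h K)

variable {K : Type*} [Field K]

theorem equivalent_weightedSumSquares_sumElim {ι κ : Type*} [Fintype ι] [Fintype κ]
    (c : ι → K) (d : κ → K) :
    (weightedSumSquares K (Sum.elim c d)).Equivalent
      ((weightedSumSquares K c).prod (weightedSumSquares K d)) :=
  ⟨⟨LinearEquiv.sumArrowLequivProdArrow ι κ K K, fun v => by simp⟩⟩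

variable {V : Type*} [AddCommGroup V] [Module K V]

theorem associated_weightedSumSquares [Invertible (2 : K)] {ι : Type*} [Fintype ι]
    (c x y : ι → K) :
    associated (R := K) (weightedSumSquares K c) x y = ∑ i, c i * (x i * y i) := by
  have h2 : (2 : K) ≠ 0 := Invertible.ne_zero 2
  have h := congrArg (fun B => B x y) (two_nsmul_associated K (weightedSumSquares K c))
  simp only [LinearMap.smul_apply, polarBilin_apply_apply, QuadraticMap.polar,
    weightedSumSquares_apply, Pi.add_apply, ← Finset.sum_sub_distrib, smul_eq_mul,
    nsmul_eq_mul, Nat.cast_ofNat] at h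
  refine mul_left_cancel₀ h2 (h.trans ?_)
  rw [Finset.mul_sum]
  exact Finset.sum_congr rfl fun i _ => by ring

theorem separatingLeft_associated_weightedSumSquares [Invertible (2 : K)] {ι : Type*} [Fintype ι]
    {c : ι → K} (hc : ∀ i, c i ≠ 0) :
    (associated (R := K) (weightedSumSquares K c)).SeparatingLeft := by
  have : NeZero (2 : K) := ⟨Invertible.ne_zero 2⟩
  refine (nondegenerate_associated_iff.2 (nondegenerate_iff_radical_eq_bot.2 ?_)).1
  rw [radical_weightedSumSquares, Submodule.eq_bot_iff]
  intro x hx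
  rw [Pi.mem_spanSubset_iff] at hx
  exact funext fun i => hx i (hc i)

/-- Splitting off a nondegenerate binary diagonal subform. -/
theorem exists_equivalent_prod_weightedSumSquares [FiniteDimensional K V] [Invertible (2 : K)]
    {q : QuadraticForm K V}
    (hq : (associated (R := K) q).SeparatingLeft) {u w : V} (hu : q u ≠ 0) (hw : q w ≠ 0)
    (huw : associated q u w = 0) :
    ∃ (m : ℕ) (c : Fin m → K), (∀ i, c i ≠ 0) ∧ finrank K V = 2 + m ∧
      q.Equivalent ((weightedSumSquares K ![q u, q w]).prod (weightedSumSquares K c)) := by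
  set B := associated (R := K) q with hB
  have hsymm : ∀ x y, B x y = B y x := fun x y => (associated_isSymm K q).eq x y
  have hBq : ∀ x, B x x = q x := fun x => associated_eq_self_apply K q x
  have hwu : B w u = 0 := by rw [hsymm, huw]
  -- The orthogonal complement of the plane spanned by `u` and `w`; `hproj` is the orthogonal
  -- projection onto it.
  let N : Submodule K V := LinearMap.ker (B u) ⊓ LinearMap.ker (B w)
  let T : (Fin 2 → K) × N →ₗ[K] V := LinearMap.coprod
    ((LinearMap.proj 0).smulRight u + (LinearMap.proj 1).smulRight w) N.subtype
  have hT : ∀ z, T z = z.1 0 • u + z.1 1 • w + (z.2 : V) := fun z => by simp [T]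
  have hN : ∀ y : N, B u y = 0 ∧ B w y = 0 := fun y => ⟨y.2.1, y.2.2⟩
  have hproj : ∀ v, v - (B u v / q u) • u - (B w v / q w) • w ∈ N := by
    intro v
    refine ⟨?_, ?_⟩
    · simp [hBq, huw, hu]
    · simp [hBq, hwu, hw]
  have hTb : Function.Bijective T := by
    refine ⟨?_, fun v => ⟨(![B u v / q u, B w v / q w], ⟨_, hproj v⟩), ?_⟩⟩
    · rw [← LinearMap.ker_eq_bot, Submodule.eq_bot_iff]
      intro z hz
      rw [LinearMap.mem_ker, hT] at hz
      have h0 : z.1 0 = 0 := by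
        have := congrArg (B u) hz
        simpa [hBq, huw, (hN z.2).1, hu] using this
      have h1 : z.1 1 = 0 := by
        have := congrArg (B w) hz
        simpa [hBq, hwu, (hN z.2).2, hw] using this
      rw [h0, h1] at hz
      refine Prod.ext (funext fun i => ?_) (Subtype.ext (by simpa using hz))
      fin_cases i
      · exact h0
      · exact h1
    · rw [hT]
      simp
  let e := LinearEquiv.ofBijective T hTb
  have he : ((weightedSumSquares K ![q u, q w]).prod (q.comp N.subtype)).Equivalent q := by
    refine ⟨⟨e, fun z => ?_⟩⟩
    change q (T z) = _
    rw [← hBq, hT]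
    simp only [map_add, map_smul, LinearMap.add_apply, LinearMap.smul_apply, smul_eq_mul, hBq, huw,
      hwu, (hN z.2).1, (hN z.2).2, hsymm _ u, hsymm (z.2 : V) w, QuadraticMap.prod_apply,
      weightedSumSquares_apply, Fin.sum_univ_two, QuadraticMap.comp_apply, Submodule.subtype_apply,
      Matrix.cons_val_zero, Matrix.cons_val_one]
    ring
  have hsep : (associated (R := K) (q.comp N.subtype)).SeparatingLeft := by
    intro y hy
    refine Subtype.ext (hq y fun v => ?_)
    have h1 := hy ⟨_, hproj v⟩
    rw [associated_comp] at h1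
    have h2 : B y (v - (B u v / q u) • u - (B w v / q w) • w) = 0 := h1
    simpa [hsymm _ u, hsymm (y : V) w, (hN y).1, (hN y).2] using h2
  obtain ⟨c, hc⟩ := equivalent_weightedSumSquares_units_of_nondegenerate' _ hsep
  refine ⟨finrank K N, fun i => c i, fun i => (c i).ne_zero, ?_, ?_⟩
  · rw [← e.finrank_eq]
    simp
  · refine he.symm.trans (Equivalent.prod (Equivalent.refl _) ?_)
    exact hc

end Diagonal

/-! ### Similarity factors and norms -/

section Similarity

variable {K : Type*} [Field K] {V : Type*} [AddCommGroup V] [Module K V]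
  {W : Type*} [AddCommGroup W] [Module K W]

theorem equivalent_smul {q : QuadraticForm K V} {q' : QuadraticForm K W} (h : q.Equivalent q')
    (a : K) : (a • q).Equivalent (a • q') := by
  obtain ⟨e⟩ := h
  exact ⟨⟨e.toLinearEquiv, fun v => congrArg (a * ·) (e.map_app v)⟩⟩

theorem equivalent_smul_self_of_equivalent {q : QuadraticForm K V} {q' : QuadraticForm K W}
    (h : q.Equivalent q') {a : K} (ha : (a • q').Equivalent q') : (a • q).Equivalent q :=
  ((equivalent_smul h a).trans ha).trans h.symm

theorem equivalent_smul_self_prod {q : QuadraticForm K V} {q' : QuadraticForm K W} {a : K}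
    (h : (a • q).Equivalent q) (h' : (a • q').Equivalent q') :
    (a • q.prod q').Equivalent (q.prod q') := by
  have : a • q.prod q' = (a • q).prod (a • q') := by
    ext x
    simp [mul_add]
  rw [this]
  exact h.prod h'

theorem equivalent_smul_self_sq (q : QuadraticForm K V) {t : K} (ht : t ≠ 0) :
    (t ^ 2 • q).Equivalent q :=
  ⟨⟨LinearEquiv.smulOfNeZero K V t ht, fun v => by
    change q (t • v) = t ^ 2 * q v
    rw [QuadraticMap.map_smul, smul_eq_mul]
    ring⟩⟩

/-- Norms `x² - e y²` are similarity factors of `⟨c, -c e⟩`. -/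
theorem equivalent_smul_self_binary (c e x y : K) (h : x ^ 2 - e * y ^ 2 ≠ 0) :
    ((x ^ 2 - e * y ^ 2) • weightedSumSquares K ![c, -c * e]).Equivalent
      (weightedSumSquares K ![c, -c * e]) := by
  -- Multiplication by `x + y√e` in the basis `1, √e`; the form is `c` times the norm form, and
  -- norms are multiplicative.
  let f : (Fin 2 → K) →ₗ[K] (Fin 2 → K) := LinearMap.pi
    ![x • LinearMap.proj 0 + (e * y) • LinearMap.proj 1, y • LinearMap.proj 0 + x • LinearMap.proj 1]
  have h0 : ∀ v, f v 0 = x * v 0 + e * y * v 1 := fun v => by simp [f]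
  have h1 : ∀ v, f v 1 = y * v 0 + x * v 1 := fun v => by simp [f]
  have hf : Function.Injective f := by
    rw [← LinearMap.ker_eq_bot, Submodule.eq_bot_iff]
    intro v hv
    have e0 := h0 v
    have e1 := h1 v
    rw [LinearMap.mem_ker.1 hv] at e0 e1
    simp only [Pi.zero_apply] at e0 e1
    have k0 : (x ^ 2 - e * y ^ 2) * v 0 = 0 := by linear_combination -x * e0 + e * y * e1
    have k1 : (x ^ 2 - e * y ^ 2) * v 1 = 0 := by linear_combination y * e0 - x * e1
    funext i
    fin_cases i
    · exact (mul_eq_zero.1 k0).resolve_left h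
    · exact (mul_eq_zero.1 k1).resolve_left h
  refine ⟨⟨LinearEquiv.ofInjectiveEndo f hf, fun v => ?_⟩⟩
  change weightedSumSquares K ![c, -c * e] (f v) = _
  simp [Fin.sum_univ_two, h0, h1]
  ring

/-- If every diagonal form over `K` that becomes isotropic over `E` contains a binary subform
`⟨c, -c e⟩` with `e` a square in `E` and `a` of the form `x² - e y²`, then `a` is a similarity
factor of every diagonal form that becomes hyperbolic over `E`. -/
theorem equivalent_smul_self_of_hasLagrangian [Invertible (2 : K)] {E : Type*} [Field E]
    [Algebra K E] {a : K} (ha : a ≠ 0)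
    (hE : ∀ (n : ℕ) (c : Fin n → K), (∀ i, c i ≠ 0) →
      IsIsotropic (weightedSumSquares E fun i => algebraMap K E (c i)) →
      ∃ (u w : Fin n → K) (e x y : K) (r : E), weightedSumSquares K c u ≠ 0 ∧ e ≠ 0 ∧
        weightedSumSquares K c w = -weightedSumSquares K c u * e ∧
        ∑ i, c i * (u i * w i) = 0 ∧ algebraMap K E e = r ^ 2 ∧ a = x ^ 2 - e * y ^ 2)
    {n : ℕ} (c : Fin n → K) (hc : ∀ i, c i ≠ 0)
    (h : HasLagrangian (weightedSumSquares E fun i => algebraMap K E (c i))) :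
    (a • weightedSumSquares K c).Equivalent (weightedSumSquares K c) := by
  induction n using Nat.strong_induction_on with
  | _ n ih =>
    obtain rfl | hn := Nat.eq_zero_or_pos n
    · exact ⟨⟨LinearEquiv.refl K _, fun v => by simp⟩⟩
    obtain ⟨u, w, e, x, y, r, hu, he, hw, huw, hr, hxy⟩ :=
      hE n c hc (h.exists_isotropic (by simpa using hn))
    have hw0 : weightedSumSquares K c w ≠ 0 := by
      rw [hw]
      exact mul_ne_zero (neg_ne_zero.2 hu) he
    have huw' : associated (weightedSumSquares K c) u w = 0 := by
      rw [associated_weightedSumSquares, huw]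
    obtain ⟨m, c', hc', hm, heq⟩ := exists_equivalent_prod_weightedSumSquares
      (separatingLeft_associated_weightedSumSquares hc) hu hw0 huw'
    rw [hw] at heq
    set b := weightedSumSquares K c u
    refine equivalent_smul_self_of_equivalent heq (equivalent_smul_self_prod ?_ ?_)
    · rw [hxy] at ha ⊢
      exact equivalent_smul_self_binary b e x y ha
    -- Over `E` the split-off plane is `⟨b, -b r²⟩`, so `HasLagrangian.of_prod` passes the
    -- Lagrangian to the complement.
    · refine ih m (by simp at hm; omega) c' hc' ?_
      have h1 := h.of_equivalent (equivalent_weightedSumSquares_map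
        (heq.trans (equivalent_weightedSumSquares_sumElim _ _).symm) E)
      have h2 : (fun i => algebraMap K E (Sum.elim ![b, -b * e] c' i)) =
          Sum.elim ![algebraMap K E b, -algebraMap K E b * r ^ 2]
            (fun i => algebraMap K E (c' i)) := by
        funext i
        rcases i with i | i
        · fin_cases i <;> simp [hr]
        · rfl
      rw [h2] at h1
      have : Invertible (2 : E) := (Invertible.map (algebraMap K E) 2).copy 2 (map_ofNat _ _).symm
      refine (h1.of_equivalent (equivalent_weightedSumSquares_sumElim _ _)).of_prod
        (Invertible.ne_zero 2) ?_ ?_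
      · simpa using hu
      · rintro rfl
        simp [he] at hr

/-- An isotropic diagonal form contains a hyperbolic plane. -/
theorem exists_hyperbolic_pair {n : ℕ} {c : Fin n → K} (h2 : (2 : K) ≠ 0) (hc : ∀ i, c i ≠ 0)
    (h : IsIsotropic (weightedSumSquares K c)) :
    ∃ u w : Fin n → K, weightedSumSquares K c u ≠ 0 ∧
      weightedSumSquares K c w = -weightedSumSquares K c u ∧ ∑ i, c i * (u i * w i) = 0 := by
  obtain ⟨z, hz, hq⟩ := h
  obtain ⟨i, hi⟩ := Function.ne_iff.1 hz
  simp only [Pi.zero_apply] at hi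
  -- This `t` makes `h = eᵢ + t z` isotropic, with `z` and `h` pairing to `cᵢ zᵢ ≠ 0`. The required
  -- vectors are `z + h` and `z - h`.
  set t := -(1 / (2 * z i)) with ht
  let h : Fin n → K := Pi.single i 1 + t • z
  simp only [weightedSumSquares_apply, smul_eq_mul] at hq ⊢
  have h1 : ∑ j, c j * (z j * h j) = c i * z i := by
    simp [h, mul_add, Finset.sum_add_distrib, Pi.single_apply]
    simp_rw [show ∀ j, c j * (z j * (t * z j)) = t * (c j * (z j * z j)) by intro j; ring]
    rw [← Finset.mul_sum, hq, mul_zero]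
  have h3 : ∑ j, c j * (h j * h j) = 0 := by
    simp_rw [show ∀ j, c j * (h j * h j) =
      c j * ((Pi.single i 1 : Fin n → K) j * (Pi.single i 1 : Fin n → K) j) +
        2 * t * (c j * (z j * (Pi.single i 1 : Fin n → K) j)) + t ^ 2 * (c j * (z j * z j)) by
      intro j; simp [h]; ring]
    rw [Finset.sum_add_distrib, Finset.sum_add_distrib, ← Finset.mul_sum, ← Finset.mul_sum, hq]
    simp [Pi.single_apply, ht]
    field_simp
    ring
  have h4 : ∀ s s' : K, ∑ j, c j * ((z j + s * h j) * (z j + s' * h j)) =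
      (s + s') * (c i * z i) := by
    intro s s'
    simp_rw [show ∀ j, c j * ((z j + s * h j) * (z j + s' * h j)) =
      c j * (z j * z j) + (s + s') * (c j * (z j * h j)) + s * s' * (c j * (h j * h j)) by
      intro j; ring]
    rw [Finset.sum_add_distrib, Finset.sum_add_distrib, ← Finset.mul_sum, ← Finset.mul_sum, hq,
      h1, h3]
    ring
  refine ⟨fun j => z j + 1 * h j, fun j => z j + (-1) * h j, ?_, ?_, ?_⟩
  · rw [h4]
    refine mul_ne_zero ?_ (mul_ne_zero (hc i) hi)
    rwa [one_add_one_eq_two]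
  · rw [h4, h4]
    ring
  · rw [h4]
    ring

/-- Every element is a similarity factor of a hyperbolic form. -/
theorem equivalent_smul_self_of_hasLagrangian_self [Invertible (2 : K)] {a : K} (ha : a ≠ 0)
    {n : ℕ} (c : Fin n → K) (hc : ∀ i, c i ≠ 0) (h : HasLagrangian (weightedSumSquares K c)) :
    (a • weightedSumSquares K c).Equivalent (weightedSumSquares K c) := by
  have h2 : (2 : K) ≠ 0 := Invertible.ne_zero 2
  refine equivalent_smul_self_of_hasLagrangian (E := K) ha (fun n c hc h => ?_) c hc h
  obtain ⟨u, w, hu, hw, huw⟩ := exists_hyperbolic_pair h2 hc h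
  -- Every `a` is a difference of two squares: `((a+1)/2)² - ((a-1)/2)²`.
  refine ⟨u, w, 1, (a + 1) / 2, (a - 1) / 2, 1, hu, one_ne_zero, by simpa using hw, huw,
    by simp, ?_⟩
  field_simp
  ring

/-- Norms from a quadratic extension are similarity factors of every form that becomes hyperbolic
over it. -/
theorem equivalent_smul_self_of_hasLagrangian_quadratic [Invertible (2 : K)] {E : Type*} [Field E]
    [Algebra K E] {d : K} {r : E} (hr : r ^ 2 = algebraMap K E d) (hd : ∀ s : K, s ^ 2 ≠ d)
    (hspan : ∀ z : E, ∃ x y : K, z = algebraMap K E x + algebraMap K E y * r)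
    {x y : K} (ha : x ^ 2 - d * y ^ 2 ≠ 0)
    {n : ℕ} (c : Fin n → K) (hc : ∀ i, c i ≠ 0)
    (h : HasLagrangian (weightedSumSquares E fun i => algebraMap K E (c i))) :
    ((x ^ 2 - d * y ^ 2) • weightedSumSquares K c).Equivalent (weightedSumSquares K c) := by
  have h2 : (2 : K) ≠ 0 := Invertible.ne_zero 2
  have hindep : ∀ s t : K, algebraMap K E s + algebraMap K E t * r = 0 → s = 0 ∧ t = 0 := by
    intro s t hst
    have ht : t = 0 := by
      by_contra ht
      refine hd (-(s / t)) ((algebraMap K E).injective ?_)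
      have ht' : algebraMap K E t ≠ 0 := by simpa using ht
      rw [← hr, map_pow, map_neg, map_div₀]
      have : r = -(algebraMap K E s / algebraMap K E t) := by
        field_simp
        linear_combination hst
      rw [this]
    subst ht
    simpa using hst
  have hd0 : d ≠ 0 := fun h0 => hd 0 (by simp [h0])
  refine equivalent_smul_self_of_hasLagrangian (E := E) ha (fun n c hc h => ?_) c hc h
  by_cases hK : IsIsotropic (weightedSumSquares K c)
  · obtain ⟨u, w, hu, hw, huw⟩ := exists_hyperbolic_pair h2 hc hK
    refine ⟨u, w, 1, (x ^ 2 - d * y ^ 2 + 1) / 2, (x ^ 2 - d * y ^ 2 - 1) / 2, 1, hu, one_ne_zero,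
      by simpa using hw, huw, by simp, ?_⟩
    field_simp
    ring
  -- Write the zero as `u + w√d`. Comparing coefficients of `1` and `√d` gives `c(u) = -d c(w)` and
  -- `u ⊥ w`, so `w, u` span `⟨c(w), -d c(w)⟩`; anisotropy over `K` forces `c(w) ≠ 0`.
  · obtain ⟨z, hz0, hz⟩ := h
    choose u w huw using fun i => hspan (z i)
    have h1 : algebraMap K E (∑ i, c i * (u i * u i) + d * ∑ i, c i * (w i * w i)) +
        algebraMap K E (2 * ∑ i, c i * (w i * u i)) * r = 0 := by
      rw [← hz]
      simp only [weightedSumSquares_apply, map_add, map_mul, map_sum, smul_eq_mul, Finset.mul_sum,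
        Finset.sum_mul, ← Finset.sum_add_distrib, huw, ← hr]
      exact Finset.sum_congr rfl fun i _ => by rw [map_ofNat]; ring
    obtain ⟨h3, h4⟩ := hindep _ _ h1
    have hw : weightedSumSquares K c w ≠ 0 := by
      intro hw
      by_cases hw0 : w = 0
      · refine hK ⟨u, fun hu0 => hz0 (funext fun i => ?_), ?_⟩
        · simp [huw i, hu0, hw0]
        · simpa [hw0] using h3
      · exact hK ⟨w, hw0, hw⟩
    refine ⟨w, u, d, x, y, r, hw, hd0, ?_, (mul_eq_zero.1 h4).resolve_left h2, hr.symm, rfl⟩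
    simp only [weightedSumSquares_apply, smul_eq_mul]
    linear_combination h3

end Similarity

/-! ### Descent from rational function fields -/

section RationalFunctions

/-- Vectors of rational functions can be rescaled to polynomial vectors that do not vanish at
zero. -/
theorem exists_primitive_multiple {M : Type*} [Field M] {ι : Type*} [Fintype ι] (u : ι → RatFunc M)
    (hu : u ≠ 0) : ∃ (l : RatFunc M) (w : ι → Polynomial M),
      (∀ i, algebraMap (Polynomial M) (RatFunc M) (w i) = l * u i) ∧
        ∃ i, Polynomial.aeval (0 : M) (w i) ≠ 0 := by
  classical
  obtain ⟨b, hb⟩ := IsLocalization.exist_integer_multiples_of_finite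
    (nonZeroDivisors (Polynomial M)) u
  choose v hv using hb
  have hb0 : algebraMap (Polynomial M) (RatFunc M) b ≠ 0 := by
    simp
  have hv' : ∀ i, algebraMap (Polynomial M) (RatFunc M) (v i) =
      algebraMap (Polynomial M) (RatFunc M) b * u i := fun i => by
    rw [hv i, Algebra.smul_def]
  obtain ⟨i, hi⟩ := Function.ne_iff.1 hu
  have hvi : v i ≠ 0 := by
    intro h0
    have := hv' i
    rw [h0, map_zero] at this
    exact mul_ne_zero hb0 hi this.symm
  -- The least such exponent is one more than the largest power of `X` dividing all entries;
  -- dividing by that power leaves an entry with nonzero constant term.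
  have hex : ∃ k : ℕ, ¬ ∀ i, (Polynomial.X : Polynomial M) ^ k ∣ v i := by
    refine ⟨(v i).natDegree + 1, fun h => ?_⟩
    have := Polynomial.natDegree_le_of_dvd (h i) hvi
    simp at this
  obtain ⟨k, hk⟩ : ∃ k, Nat.find hex = k + 1 := by
    refine Nat.exists_eq_succ_of_ne_zero fun h0 => ?_
    refine Nat.find_spec hex ?_
    rw [h0]
    simp
  have hdiv : ∀ i, (Polynomial.X : Polynomial M) ^ k ∣ v i :=
    not_not.1 (Nat.find_min hex (m := k) (by omega))
  choose w hw using hdiv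
  have hspec := Nat.find_spec hex
  rw [hk, not_forall] at hspec
  obtain ⟨j, hj⟩ := hspec
  have hX : algebraMap (Polynomial M) (RatFunc M) (Polynomial.X ^ k) ≠ 0 := by
    rw [map_pow, RatFunc.algebraMap_X]
    exact pow_ne_zero k RatFunc.X_ne_zero
  refine ⟨algebraMap (Polynomial M) (RatFunc M) b /
    algebraMap (Polynomial M) (RatFunc M) (Polynomial.X ^ k), w, fun i => ?_, j, fun h0 => hj ?_⟩
  · have := hv' i
    rw [hw i, map_mul] at this
    rw [div_mul_eq_mul_div, eq_div_iff hX, ← this, mul_comm]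
  · rw [hw j, pow_succ]
    refine mul_dvd_mul_left _ (Polynomial.X_dvd_iff.2 ?_)
    rwa [Polynomial.coeff_zero_eq_aeval_zero]

/-- There are field extensions of arbitrarily large transcendence degree along which Lagrangians
descend. -/
theorem exists_algebraicIndependent_hasLagrangian_descent {L : Type u} [Field L]
    (h2 : (2 : L) ≠ 0) (n : ℕ) :
    ∃ (M : Type u) (_ : Field M) (_ : Algebra L M) (T : Fin n → M), AlgebraicIndependent L T ∧
      ∀ (m : ℕ) (c : Fin m → L),
        HasLagrangian (weightedSumSquares M fun i => algebraMap L M (c i)) →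
          HasLagrangian (weightedSumSquares L c) := by
  induction n with
  | zero =>
    exact ⟨L, inferInstance, inferInstance, Fin.elim0,
      algebraicIndependent_empty_type_iff.2 Function.injective_id, fun m c h => h⟩
  | succ n ih =>
    obtain ⟨M, _, _, T, hT, hM⟩ := ih
    have hX : AlgebraicIndependent M fun _ : Unit => (RatFunc.X : RatFunc M) :=
      algebraicIndependent_unique_type_iff.2 RatFunc.transcendental_X
    have hTX := hT.sumElim_comp hX
    let g : Fin (n + 1) → Unit ⊕ Fin n := Fin.cons (Sum.inl ()) Sum.inr
    have hg : Function.Injective g := by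
      rw [Fin.cons_injective_iff]
      exact ⟨by simp, Sum.inr_injective⟩
    refine ⟨RatFunc M, inferInstance, inferInstance, _, hTX.comp g hg, fun m c h => hM m c ?_⟩
    -- The place is `X ↦ 0`, defined on `M[X]`.
    refine HasLagrangian.specialize (R := Polynomial M) (E := RatFunc M) ?_
      ((Polynomial.aeval (0 : M)).restrictScalars L) (IsFractionRing.injective _ _)
      (fun u hu => exists_primitive_multiple u hu) h
    intro h0
    refine h2 ((algebraMap L (RatFunc M)).injective ?_)
    rw [map_ofNat, map_zero, h0]

end RationalFunctions

/-! ### Generic points of a quadric -/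

section Quadric

variable {F : Type*} [Field F] {ι : Type*} [Fintype ι]

/-- The rational parametrization of the quadric `∑ cᵢ zᵢ² = 0` by reflecting a rational point
`x`. -/
def quadricPoint {M : Type*} [CommRing M] (c x : ι → M) (t : M) (T : ι → M) (j : ι) : M :=
  t * ((∑ i, c i * T i ^ 2) * x j - 2 * (∑ i, c i * (x i * T i)) * T j)

/-- The point is the reflection of `x` along `T`, multiplied by `t` times the value at `T` to clear
the denominator; reflections preserve the form. -/
theorem quadricPoint_isotropic {M : Type*} [CommRing M] {c x : ι → M}
    (hx : ∑ i, c i * x i ^ 2 = 0) (t : M) (T : ι → M) :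
    ∑ j, c j * quadricPoint c x t T j ^ 2 = 0 := by
  simp only [quadricPoint]
  generalize hP : ∑ i, c i * T i ^ 2 = P
  generalize hB : ∑ i, c i * (x i * T i) = B
  simp_rw [show ∀ j, c j * (t * (P * x j - 2 * B * T j)) ^ 2 = t ^ 2 * P ^ 2 * (c j * x j ^ 2) -
    4 * t ^ 2 * P * B * (c j * (x j * T j)) + 4 * t ^ 2 * B ^ 2 * (c j * T j ^ 2) by intro j; ring]
  rw [Finset.sum_add_distrib, Finset.sum_sub_distrib, ← Finset.mul_sum, ← Finset.mul_sum,
    ← Finset.mul_sum, hx, hP, hB]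
  ring

theorem map_quadricPoint {M N : Type*} [CommRing M] [CommRing N] (f : M →+* N) (c x : ι → M)
    (t : M) (T : ι → M) (j : ι) :
    f (quadricPoint c x t T j) =
      quadricPoint (fun i => f (c i)) (fun i => f (x i)) (f t) (fun i => f (T i)) j := by
  simp [quadricPoint, map_ofNat f 2]

/-- A generic point of the quadric `∑ cᵢ zᵢ² = 0` that is not orthogonal to `x`. -/
theorem exists_generic_quadric_point {ι : Type v} [Fintype ι] {L : Type u} [Field L] (h2 : (2 : L) ≠ 0) {c x : ι → L}
    (hc : ∀ i, c i ≠ 0) (hx : ∑ i, c i * x i ^ 2 = 0) (hx0 : x ≠ 0) (j₀ : ι) :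
    ∃ (Ω : Type (max u v)) (_ : Field Ω) (_ : Algebra L Ω) (S : ι → Ω),
      AlgebraicIndependent L (fun j : {j // j ≠ j₀} => S j) ∧
      ∑ i, algebraMap L Ω (c i) * S i ^ 2 = 0 ∧
      ∑ i, algebraMap L Ω (c i) * (algebraMap L Ω (x i) * S i) ≠ 0 := by
  classical
  let A := MvPolynomial {j // j ≠ j₀} L
  let Ω := AlgebraicClosure (FractionRing A)
  have hinj : Function.Injective (algebraMap A Ω) := by
    rw [IsScalarTower.algebraMap_eq A (FractionRing A) Ω]
    exact (algebraMap (FractionRing A) Ω).injective.comp (IsFractionRing.injective A _)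
  let X : {j // j ≠ j₀} → Ω := fun j => algebraMap A Ω (MvPolynomial.X j)
  have hX : AlgebraicIndependent L X :=
    (MvPolynomial.algebraicIndependent_X _ L).map' (f := IsScalarTower.toAlgHom L A Ω) hinj
  have hcΩ : ∀ i, algebraMap L Ω (c i) ≠ 0 := fun i => by simpa using hc i
  have h2Ω : (2 : Ω) ≠ 0 := by
    intro h0
    refine h2 ((algebraMap L Ω).injective ?_)
    rw [map_ofNat, map_zero, h0]
  obtain ⟨s, hs⟩ := IsAlgClosed.exists_pow_nat_eq
    (-(∑ j : {j // j ≠ j₀}, algebraMap L Ω (c j) * X j ^ 2) / algebraMap L Ω (c j₀)) two_pos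
  have key : ∀ s : Ω, s ^ 2 =
      -(∑ j : {j // j ≠ j₀}, algebraMap L Ω (c j) * X j ^ 2) / algebraMap L Ω (c j₀) →
      algebraMap L Ω (c j₀) * (algebraMap L Ω (x j₀) * s) +
        ∑ j : {j // j ≠ j₀}, algebraMap L Ω (c j) * (algebraMap L Ω (x j) * X j) ≠ 0 →
      ∃ S : ι → Ω, AlgebraicIndependent L (fun j : {j // j ≠ j₀} => S j) ∧
        ∑ i, algebraMap L Ω (c i) * S i ^ 2 = 0 ∧
        ∑ i, algebraMap L Ω (c i) * (algebraMap L Ω (x i) * S i) ≠ 0 := by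
    intro s hs hne
    let S : ι → Ω := fun j => if h : j = j₀ then s else X ⟨j, h⟩
    have hS0 : S j₀ = s := by simp [S]
    have hSX : ∀ j : {j // j ≠ j₀}, S j = X j := fun j => by simp [S, j.2]
    refine ⟨S, ?_, ?_, ?_⟩
    · simpa only [hSX] using hX
    · rw [Fintype.sum_eq_add_sum_subtype_ne _ j₀]
      simp only [hS0, hSX]
      rw [hs, mul_div_cancel₀ _ (hcΩ j₀)]
      ring
    · rw [Fintype.sum_eq_add_sum_subtype_ne _ j₀]
      simpa only [hS0, hSX] using hne
  refine ⟨Ω, inferInstance, inferInstance, ?_⟩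
  -- One of the two roots `s`, `-s` works. If both pairings with `x` vanished, their sum would be a
  -- linear relation among the independent `X j`, forcing first `x j = 0` for `j ≠ j₀` and then `x =
  -- 0`.
  by_cases h1 : algebraMap L Ω (c j₀) * (algebraMap L Ω (x j₀) * s) +
      ∑ j : {j // j ≠ j₀}, algebraMap L Ω (c j) * (algebraMap L Ω (x j) * X j) ≠ 0
  · exact key s hs h1
  refine key (-s) (by rw [neg_sq, hs]) fun h3 => hx0 ?_
  rw [not_not] at h1
  have h4 : ∑ j : {j // j ≠ j₀}, (c j * x j) • X j = 0 := by
    have h5 : (2 : Ω) *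
        ∑ j : {j // j ≠ j₀}, algebraMap L Ω (c j) * (algebraMap L Ω (x j) * X j) = 0 := by
      linear_combination h1 + h3
    rw [← (mul_eq_zero.1 h5).resolve_left h2Ω]
    exact Finset.sum_congr rfl fun j _ => by rw [Algebra.smul_def, map_mul, mul_assoc]
  have h6 := Fintype.linearIndependent_iff.1 hX.linearIndependent _ h4
  have h7 : ∀ j, j ≠ j₀ → x j = 0 := fun j hj =>
    (mul_eq_zero.1 (h6 ⟨j, hj⟩)).resolve_left (hc j)
  funext j
  by_cases hj : j = j₀
  · subst hj
    rw [Fintype.sum_eq_single j fun i hi => by rw [h7 i hi]; ring] at hx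
    simpa [hc j] using hx
  · exact h7 j hj

/-- Independence may be checked after a specialization of the parameters, and the parametrization
specializes to the generic point `S`. -/
theorem algebraicIndependent_quadricPoint {L M : Type*} [Field L] [Algebra F L] [Field M]
    [Algebra L M] [Algebra F M] [IsScalarTower F L M] (h2 : (2 : L) ≠ 0) {c : ι → F} {x : ι → L}
    (hc : ∀ i, c i ≠ 0) (hx : ∑ i, algebraMap F L (c i) * x i ^ 2 = 0) (hx0 : x ≠ 0) (j₀ : ι)
    {T : Option ι → M} (hT : AlgebraicIndependent L T) :
    AlgebraicIndependent F (fun j : {j // j ≠ j₀} =>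
      quadricPoint (fun i => algebraMap F M (c i)) (fun i => algebraMap L M (x i)) (T none)
        (fun i => T (some i)) j) := by
  obtain ⟨Ω, _, _, S, hS, hS0, hβ⟩ := exists_generic_quadric_point h2
    (c := fun i => algebraMap F L (c i)) (fun i => by simpa using hc i) hx hx0 j₀
  set β := ∑ i, algebraMap L Ω (algebraMap F L (c i)) * (algebraMap L Ω (x i) * S i) with hβ'
  have h2Ω : (2 : Ω) ≠ 0 := by
    intro h0
    refine h2 ((algebraMap L Ω).injective ?_)
    rw [map_ofNat, map_zero, h0]
  let P : {j // j ≠ j₀} → MvPolynomial (Option ι) L := fun j =>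
    quadricPoint (fun i => algebraMap L _ (algebraMap F L (c i))) (fun i => algebraMap L _ (x i))
      (MvPolynomial.X none) (fun i => MvPolynomial.X (some i)) j
  -- Since `S` is isotropic, the parametrization at `T = S` is `-2βt S`; the value `t = -1/(2β)`
  -- returns `S` itself. This is why the scaling parameter `t` is needed.
  let ε : MvPolynomial (Option ι) L →ₐ[L] Ω :=
    MvPolynomial.aeval fun o => o.elim (-(1 / (2 * β))) S
  have hεP : ε ∘ P = fun j : {j // j ≠ j₀} => S j := by
    funext j
    change (ε : MvPolynomial (Option ι) L →+* Ω) (quadricPoint _ _ _ _ _) = _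
    rw [map_quadricPoint]
    simp only [RingHom.coe_coe, AlgHom.commutes, ε, MvPolynomial.aeval_X, Option.elim_none,
      Option.elim_some, quadricPoint]
    rw [hS0, ← hβ']
    field_simp
    ring
  have hP : AlgebraicIndependent L P := AlgebraicIndependent.of_comp ε (hεP ▸ hS)
  have hPM := (hP.map' (f := MvPolynomial.aeval T) hT).restrictScalars (R := F)
    (algebraMap F L).injective
  convert hPM using 1
  funext j
  change _ = ((MvPolynomial.aeval T : MvPolynomial (Option ι) L →ₐ[L] M) :
    MvPolynomial (Option ι) L →+* M) (quadricPoint _ _ _ _ _)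
  rw [map_quadricPoint]
  simp only [RingHom.coe_coe, AlgHom.commutes, MvPolynomial.aeval_X,
    ← IsScalarTower.algebraMap_apply F L M]

end Quadric

/-! ### The coordinate ring in diagonal coordinates -/

section DiagonalCoordinates

variable {F : Type*} [Field F] {V : Type*} [AddCommGroup V] [Module F V] {ι : Type*} [Fintype ι]
  (b : Basis ι F V)

/-- The coordinate functions of a diagonalization, as linear polynomials in the coordinates of the
basis `b`. -/
def diagonalCoordinate (e : V ≃ₗ[F] (ι → F)) (j : ι) : MvPolynomial ι F :=
  ∑ i, MvPolynomial.C (e (b i) j) * MvPolynomial.X i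

/-- The ideal defining `F(p)` uses an arbitrary basis; in diagonal coordinates its generator
exhibits the square of one coordinate as a combination of the squares of the others. -/
theorem polynomial_eq_sum_diagonalCoordinate [Invertible (2 : F)] {p : QuadraticForm F V} {c : ι → F}
    (e : p.IsometryEquiv (weightedSumSquares F c)) :
    polynomial p b =
      ∑ j, MvPolynomial.C (c j) * diagonalCoordinate b e.toLinearEquiv j ^ 2 := by
  have hass : ∀ v w, associated p v w = ∑ j, c j * (e v j * e w j) := by
    intro v w
    have h : p = (weightedSumSquares F c).comp (e.toLinearEquiv : V →ₗ[F] (ι → F)) := by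
      ext v
      exact (e.map_app v).symm
    conv_lhs => rw [h]
    rw [associated_comp]
    exact associated_weightedSumSquares c (e v) (e w)
  have hterm : ∀ j, MvPolynomial.C (c j) * diagonalCoordinate b e.toLinearEquiv j ^ 2 =
      ∑ i, ∑ k, MvPolynomial.C (c j * (e (b i) j * e (b k) j)) *
        (MvPolynomial.X i * MvPolynomial.X k) := by
    intro j
    rw [diagonalCoordinate, pow_two, Finset.sum_mul_sum, Finset.mul_sum]
    refine Finset.sum_congr rfl fun i _ => ?_
    rw [Finset.mul_sum]
    refine Finset.sum_congr rfl fun k _ => ?_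
    simp only [map_mul]
    change MvPolynomial.C (c j) * (MvPolynomial.C (e (b i) j) * _ *
      (MvPolynomial.C (e (b k) j) * _)) = _
    ring
  simp only [hterm, polynomial, hass, map_sum, Finset.sum_mul]
  rw [Finset.sum_comm (f := fun j i => ∑ k, MvPolynomial.C (c j * (e (b i) j * e (b k) j)) *
    (MvPolynomial.X i * MvPolynomial.X k))]
  exact Finset.sum_congr rfl fun i _ => Finset.sum_comm

theorem X_eq_sum_diagonalCoordinate [DecidableEq ι] (e : V ≃ₗ[F] (ι → F)) (i : ι) :
    (MvPolynomial.X i : MvPolynomial ι F) =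
      ∑ j, MvPolynomial.C (b.repr (e.symm (Pi.single j 1)) i) * diagonalCoordinate b e j := by
  have h : ∀ k, ∑ j, b.repr (e.symm (Pi.single j 1)) i * e (b k) j = if k = i then 1 else 0 := by
    intro k
    have h1 : ∑ j, e (b k) j • e.symm (Pi.single j 1) = b k := by
      apply e.injective
      simp only [map_sum, map_smul, LinearEquiv.apply_symm_apply]
      funext l
      simp [Pi.single_apply]
    have h2 := congrArg (fun v => b.repr v i) h1
    simp only [map_sum, map_smul, Finsupp.coe_finsetSum, Finset.sum_apply, Finsupp.smul_apply,
      smul_eq_mul, Basis.repr_self, Finsupp.single_apply] at h2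
    rw [← h2]
    exact Finset.sum_congr rfl fun j _ => mul_comm _ _
  simp only [diagonalCoordinate, Finset.mul_sum, ← mul_assoc, ← map_mul]
  rw [Finset.sum_comm]
  simp only [← Finset.sum_mul, ← map_sum, h]
  simp

/-- The homomorphism that sends the diagonal coordinates to `z`. -/
def evalDiagonal [DecidableEq ι] (e : V ≃ₗ[F] (ι → F)) {M : Type*} [CommRing M] [Algebra F M]
    (z : ι → M) : MvPolynomial ι F →ₐ[F] M :=
  MvPolynomial.aeval fun i => ∑ j, algebraMap F M (b.repr (e.symm (Pi.single j 1)) i) * z j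

theorem evalDiagonal_diagonalCoordinate [DecidableEq ι] (e : V ≃ₗ[F] (ι → F)) {M : Type*}
    [CommRing M] [Algebra F M] (z : ι → M) (j : ι) :
    evalDiagonal b e z (diagonalCoordinate b e j) = z j := by
  have h : ∀ k, ∑ i, e (b i) j * b.repr (e.symm (Pi.single k 1)) i = if k = j then 1 else 0 := by
    intro k
    have h1 := congrArg (fun v => e v j) (b.sum_repr (e.symm (Pi.single k 1)))
    simp only [map_sum, map_smul, Finset.sum_apply, Pi.smul_apply, smul_eq_mul,
      LinearEquiv.apply_symm_apply, Pi.single_apply] at h1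
    rw [← Finset.sum_congr rfl fun i _ => mul_comm _ _, h1]
    simp [eq_comm]
  simp only [evalDiagonal, diagonalCoordinate, map_sum, map_mul, MvPolynomial.aeval_C,
    MvPolynomial.aeval_X, Finset.mul_sum, ← mul_assoc]
  rw [Finset.sum_comm]
  simp only [← Finset.sum_mul, ← map_mul, ← map_sum, h]
  simp

/-- A point of the quadric `p = 0` over a domain, all but one of whose diagonal coordinates are
algebraically independent, is generic. -/
theorem injective_lift_evalDiagonal [Invertible (2 : F)] [DecidableEq ι] {p : QuadraticForm F V} {c : ι → F}
    (e : p.IsometryEquiv (weightedSumSquares F c))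
    [(Ideal.span {polynomial p b}).IsPrime] {M : Type*} [Field M] [Algebra F M] {z : ι → M}
    (hz : ∀ a ∈ Ideal.span {polynomial p b}, evalDiagonal b e.toLinearEquiv z a = 0) {j₀ : ι}
    (hc : c j₀ ≠ 0)
    (hind : AlgebraicIndependent F (fun j : {j // j ≠ j₀} => z j)) :
    Function.Injective (Ideal.Quotient.liftₐ _ (evalDiagonal b e.toLinearEquiv z) hz) := by
  set I := Ideal.span {polynomial p b} with hI
  let Z : ι → MvPolynomial ι F ⧸ I := fun j =>
    Ideal.Quotient.mkₐ F I (diagonalCoordinate b e.toLinearEquiv j)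
  let G : MvPolynomial {j // j ≠ j₀} F →ₐ[F] MvPolynomial ι F ⧸ I :=
    MvPolynomial.aeval fun j => Z j
  set φ := Ideal.Quotient.liftₐ I (evalDiagonal b e.toLinearEquiv z) hz with hφ
  have hφZ : ∀ j, φ (Z j) = z j := fun j =>
    evalDiagonal_diagonalCoordinate b e.toLinearEquiv z j
  algebraize [G.toRingHom]
  have hGX : ∀ j : {j // j ≠ j₀}, algebraMap (MvPolynomial {j // j ≠ j₀} F) (MvPolynomial ι F ⧸ I)
      (MvPolynomial.X j) = Z j := fun j => MvPolynomial.aeval_X _ _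
  have hGC : ∀ a : F, algebraMap (MvPolynomial {j // j ≠ j₀} F) (MvPolynomial ι F ⧸ I)
      (MvPolynomial.C a) = algebraMap F _ a := fun a => MvPolynomial.aeval_C _ _
  -- Noether normalization: the relation `p = 0` makes `Z j₀` integral over the other coordinates.
  have hZ : ∀ j, IsIntegral (MvPolynomial {j // j ≠ j₀} F) (Z j) := by
    have hne : ∀ j : {j // j ≠ j₀}, IsIntegral (MvPolynomial {j // j ≠ j₀} F) (Z j) := fun j => by
      rw [← hGX]
      exact isIntegral_algebraMap
    intro j
    by_cases hj : j = j₀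
    · subst hj
      refine IsIntegral.of_pow two_pos ?_
      have h0 : ∑ i, algebraMap F (MvPolynomial ι F ⧸ I) (c i) * Z i ^ 2 = 0 := by
        have h1 : Ideal.Quotient.mkₐ F I (polynomial p b) = 0 :=
          Ideal.Quotient.eq_zero_iff_mem.2 (Ideal.mem_span_singleton_self _)
        rw [polynomial_eq_sum_diagonalCoordinate b e] at h1
        simpa only [map_sum, map_mul, map_pow, ← MvPolynomial.algebraMap_eq,
          AlgHom.commutes] using h1
      rw [Fintype.sum_eq_add_sum_subtype_ne _ j] at h0
      have h2 : Z j ^ 2 = -(algebraMap F (MvPolynomial ι F ⧸ I) (c j)⁻¹ *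
          ∑ i : {i // i ≠ j}, algebraMap F (MvPolynomial ι F ⧸ I) (c i) * Z i ^ 2) := by
        have h3 : algebraMap F (MvPolynomial ι F ⧸ I) (c j)⁻¹ *
            algebraMap F (MvPolynomial ι F ⧸ I) (c j) = 1 := by
          rw [← map_mul, inv_mul_cancel₀ hc, map_one]
        linear_combination algebraMap F (MvPolynomial ι F ⧸ I) (c j)⁻¹ * h0 - Z j ^ 2 * h3
      rw [h2]
      simp only [← hGC]
      exact (isIntegral_algebraMap.mul (IsIntegral.sum _ fun i _ =>
        isIntegral_algebraMap.mul ((hne i).pow 2))).neg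
    · exact hne ⟨j, hj⟩
  have hint : Algebra.IsIntegral (MvPolynomial {j // j ≠ j₀} F) (MvPolynomial ι F ⧸ I) := by
    refine ⟨fun y => ?_⟩
    obtain ⟨P, rfl⟩ := Ideal.Quotient.mkₐ_surjective F I y
    induction P using MvPolynomial.induction_on with
    | C a =>
      rw [← MvPolynomial.algebraMap_eq, AlgHom.commutes, ← hGC]
      exact isIntegral_algebraMap
    | add P Q hP hQ =>
      rw [map_add]
      exact hP.add hQ
    | mul_X P i hP =>
      rw [map_mul]
      refine hP.mul ?_
      rw [X_eq_sum_diagonalCoordinate b e.toLinearEquiv i]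
      simp only [map_sum, map_mul]
      refine IsIntegral.sum _ fun j _ => IsIntegral.mul ?_ (hZ j)
      rw [← MvPolynomial.algebraMap_eq, AlgHom.commutes, ← hGC]
      exact isIntegral_algebraMap
  have hφG : ∀ N, φ (algebraMap (MvPolynomial {j // j ≠ j₀} F) (MvPolynomial ι F ⧸ I) N) =
      MvPolynomial.aeval (fun j : {j // j ≠ j₀} => z j) N := by
    intro N
    change (φ.comp G) N = _
    congr 1
    refine MvPolynomial.algHom_ext fun j => ?_
    simp [G, hφZ]
  -- In an integral extension by a domain, a nonzero ideal meets the base ring nontrivially. The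
  -- kernel of `φ` meets it in zero because the `z j`, `j ≠ j₀`, are independent.
  have hker : RingHom.ker (φ : MvPolynomial ι F ⧸ I →+* M) = ⊥ := by
    refine Ideal.eq_bot_of_comap_eq_bot (R := MvPolynomial {j // j ≠ j₀} F) ?_
    rw [eq_bot_iff]
    intro N hN
    have hN' : φ (algebraMap (MvPolynomial {j // j ≠ j₀} F) (MvPolynomial ι F ⧸ I) N) = 0 := hN
    rw [hφG] at hN'
    exact (injective_iff_map_eq_zero _).1 hind N hN'
  exact (RingHom.injective_iff_ker_eq_bot _).2 hker

end DiagonalCoordinates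

/-! ### From the function field to any field where `p` is isotropic -/

section FunctionField

variable {F : Type*} [Field F] [Invertible (2 : F)] {V : Type*} [AddCommGroup V] [Module F V]
  [FiniteDimensional F V] [Nontrivial V]

/-- If the diagonalization of `p` has a non-trivial zero over `L`, then diagonal forms that become
hyperbolic over `F(p)` become hyperbolic over `L`. -/
theorem HasLagrangian.of_functionField {p : QuadraticForm F V} (hp : p.Nondegenerate)
    {c : Fin (finrank F V) → F} (hc : ∀ i, c i ≠ 0) (e : p.IsometryEquiv (weightedSumSquares F c))
    {m : ℕ} {d : Fin m → F}
    (h : HasLagrangian (weightedSumSquares (FunctionField p hp) fun i =>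
      algebraMap F (FunctionField p hp) (d i)))
    {L : Type u} [Field L] [Algebra F L]
    (hL : IsIsotropic (weightedSumSquares L fun i => algebraMap F L (c i))) :
    HasLagrangian (weightedSumSquares L fun i => algebraMap F L (d i)) := by
  have h2 : (2 : F) ≠ 0 := Invertible.ne_zero 2
  have h2L : (2 : L) ≠ 0 := by
    intro h0
    refine h2 ((algebraMap F L).injective ?_)
    rw [map_ofNat, map_zero, h0]
  have h2p : (2 : FunctionField p hp) ≠ 0 := by
    intro h0
    refine h2 ((algebraMap F (FunctionField p hp)).injective ?_)
    rw [map_ofNat, map_zero, h0]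
  -- It is enough to embed `F(p)` over `F` in some extension `M` of `L` from which Lagrangians
  -- descend.
  suffices ∃ (M : Type u) (_ : Field M) (_ : Algebra L M) (_ : Algebra F M)
      (_ : IsScalarTower F L M) (f : FunctionField p hp →ₐ[F] M),
      ∀ (m : ℕ) (c : Fin m → L), HasLagrangian (weightedSumSquares M fun i => algebraMap L M (c i)) →
        HasLagrangian (weightedSumSquares L c) by
    obtain ⟨M, _, _, _, _, f, hM⟩ := this
    refine hM m _ ?_
    simp only [← IsScalarTower.algebraMap_apply F L M]
    refine HasLagrangian.specialize (R := FunctionField p hp) (E := FunctionField p hp) h2p f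
      Function.injective_id (fun u hu => ?_) h
    obtain ⟨i, hi⟩ := Function.ne_iff.1 hu
    exact ⟨1, u, by simp, i, by simpa using hi⟩
  -- In the exceptional cases `F(p)` is `F`, and `M = L` suffices.
  by_cases hex : finrank F V = 1 ∨ p.Equivalent (hyperbolicPlane F)
  · let f := (AlgEquiv.ofBijective (Algebra.ofId F (FunctionField p hp))
      (bijective_algebraMap_functionField p hp hex)).symm
    exact ⟨L, inferInstance, inferInstance, inferInstance, inferInstance,
      (Algebra.ofId F L).comp f, fun m c h => h⟩
  · obtain ⟨M, _, _, T, hT, hM⟩ :=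
      -- One parameter for each coordinate of the reflecting vector and one for the scale `t`.
      exists_algebraicIndependent_hasLagrangian_descent h2L (finrank F V + 1)
    obtain ⟨x, hx0, hx⟩ := hL
    obtain ⟨j₀, -⟩ := Function.ne_iff.1 hx0
    let _ : Algebra F M := ((algebraMap L M).comp (algebraMap F L)).toAlgebra
    have : IsScalarTower F L M := IsScalarTower.of_algebraMap_eq fun _ => rfl
    have hx' : ∑ i, algebraMap F L (c i) * x i ^ 2 = 0 := by
      simpa [pow_two] using hx
    let T' : Option (Fin (finrank F V)) → M := fun o => T (o.elim 0 Fin.succ)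
    have hT' : AlgebraicIndependent L T' := by
      refine hT.comp _ fun o o' ho => ?_
      rcases o with _ | i <;> rcases o' with _ | i'
      · rfl
      · exact absurd ho.symm (Fin.succ_ne_zero i')
      · exact absurd ho (Fin.succ_ne_zero i)
      · exact congrArg some (Fin.succ_injective _ ho)
    let z : Fin (finrank F V) → M := quadricPoint (fun i => algebraMap F M (c i))
      (fun i => algebraMap L M (x i)) (T' none) (fun i => T' (some i))
    have hz : ∑ i, algebraMap F M (c i) * z i ^ 2 = 0 := by
      refine quadricPoint_isotropic ?_ _ _
      rw [← map_zero (algebraMap L M), ← hx']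
      simp only [map_sum, map_mul, map_pow, ← IsScalarTower.algebraMap_apply]
    let b := finBasis F V
    have hI : functionFieldIdeal p hp = Ideal.span {polynomial p b} := if_neg hex
    have hprime : (functionFieldIdeal p hp).IsPrime := inferInstance
    rw [hI] at hprime
    have hzero : ∀ a ∈ Ideal.span {polynomial p b}, evalDiagonal b e.toLinearEquiv z a = 0 := by
      intro a ha
      obtain ⟨a', rfl⟩ := Ideal.mem_span_singleton.1 ha
      rw [map_mul, polynomial_eq_sum_diagonalCoordinate b e]
      simp only [map_sum, map_mul, map_pow, evalDiagonal_diagonalCoordinate,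
        ← MvPolynomial.algebraMap_eq, AlgHom.commutes, hz, zero_mul]
    have hinj := injective_lift_evalDiagonal b e hzero (hc j₀)
      (algebraicIndependent_quadricPoint h2L hc hx' hx0 j₀ hT')
    let ψ := (Ideal.Quotient.liftₐ _ (evalDiagonal b e.toLinearEquiv z) hzero).comp
      (Ideal.quotientEquivAlgOfEq F hI).toAlgHom
    have hψ : Function.Injective ψ := hinj.comp (Ideal.quotientEquivAlgOfEq F hI).injective
    exact ⟨M, inferInstance, inferInstance, inferInstance, inferInstance,
      IsFractionRing.liftAlgHom (K := FunctionField p hp) hψ, hM⟩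

end FunctionField

/-! ### Isotropy factors and the conclusion -/

/-- If `⟨1, -a⟩ ⊗ q` is isotropic, then `q` takes values `q v = a q w` with `v`, `w` not both
zero. -/
theorem exists_of_mem_isotropyFactors {K : Type*} [Field K] [Invertible (2 : K)] {V : Type*}
    [AddCommGroup V] [Module K V] {q : QuadraticForm K V} {a : Kˣ} (ha : a ∈ isotropyFactors q) :
    ∃ v w : V, ¬ (v = 0 ∧ w = 0) ∧ q v = a * q w := by
  obtain ⟨t, ht0, ht⟩ := ha
  set P := weightedSumSquares K ![(1 : K), -(a : K)] with hP
  let e₀ : Fin 2 → K := Pi.single 0 1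
  let e₁ : Fin 2 → K := Pi.single 1 1
  have hdec : ∀ t : (Fin 2 → K) ⊗[K] V, ∃ v w : V, t = e₀ ⊗ₜ v + e₁ ⊗ₜ w := by
    intro t
    induction t using TensorProduct.induction_on with
    | zero => exact ⟨0, 0, by simp⟩
    | tmul x v =>
      refine ⟨x 0 • v, x 1 • v, ?_⟩
      have hx : x = x 0 • e₀ + x 1 • e₁ := by
        funext i
        fin_cases i <;> simp [e₀, e₁]
      conv_lhs => rw [hx]
      rw [TensorProduct.add_tmul, TensorProduct.smul_tmul, TensorProduct.smul_tmul]
    | add s t hs ht =>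
      obtain ⟨v, w, rfl⟩ := hs
      obtain ⟨v', w', rfl⟩ := ht
      refine ⟨v + v', w + w', ?_⟩
      rw [TensorProduct.tmul_add, TensorProduct.tmul_add]
      abel
  obtain ⟨v, w, rfl⟩ := hdec t
  refine ⟨v, w, fun h => ht0 (by simp [h.1, h.2]), ?_⟩
  have h01 : associated (R := K) P e₀ e₁ = 0 := by
    rw [hP, associated_weightedSumSquares]
    simp [e₀, e₁]
  -- The bilinear form of a tensor product is the product of the bilinear forms, and `e₀ ⊥ e₁`.
  have hpolar : polar (QuadraticForm.tmul P q) (e₀ ⊗ₜ v) (e₁ ⊗ₜ w) = 0 := by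
    have h := congrArg (fun B => B (e₀ ⊗ₜ[K] v) (e₁ ⊗ₜ[K] w))
      (two_nsmul_associated K (QuadraticForm.tmul P q))
    simp only [polarBilin_apply_apply] at h
    rw [← h, associated_tmul]
    simp [h01]
  rw [QuadraticMap.map_add (QuadraticForm.tmul P q), hpolar, QuadraticForm.tensorDistrib_tmul,
    QuadraticForm.tensorDistrib_tmul] at ht
  have hP0 : P e₀ = 1 := by simp [hP, e₀, Fin.sum_univ_two]
  have hP1 : P e₁ = -a := by simp [hP, e₁, Fin.sum_univ_two]
  rw [hP0, hP1] at ht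
  simp only [smul_eq_mul] at ht
  linear_combination ht

/-- The quadratic extension `K(√d)`. -/
theorem exists_quadratic_extension {K : Type u} [Field K] {d : K} (hd : ∀ s : K, s ^ 2 ≠ d) :
    ∃ (E : Type u) (_ : Field E) (_ : Algebra K E) (r : E), r ^ 2 = algebraMap K E d ∧
      ∀ z : E, ∃ x y : K, z = algebraMap K E x + algebraMap K E y * r := by
  have : Fact (∀ r : K, r ^ 2 ≠ d + 0 * r) := ⟨fun r => by simpa using hd r⟩
  refine ⟨QuadraticAlgebra K d 0, inferInstance, inferInstance, ⟨0, 1⟩, ?_,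
    fun z => ⟨z.re, z.im, ?_⟩⟩
  · rw [pow_two]
    ext <;> simp
  · ext <;> simp

/-- If `x` and `y` are vectors of a diagonal form `c` with `c(x) = a c(y)`, and `d` becomes
hyperbolic over all extensions of `K` over which `c` becomes isotropic, then `a` is a similarity
factor of `d`. -/
theorem equivalent_smul_self_of_isotropic_imp {K : Type u} [Field K] [Invertible (2 : K)] {m n : ℕ}
    {c : Fin n → K} {d : Fin m → K} (hd : ∀ i, d i ≠ 0)
    (h : ∀ (E : Type u) [Field E] [Algebra K E],
      IsIsotropic (weightedSumSquares E fun i => algebraMap K E (c i)) →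
        HasLagrangian (weightedSumSquares E fun i => algebraMap K E (d i)))
    {a : K} (ha : a ≠ 0) {x y : Fin n → K} (hxy : ¬ (x = 0 ∧ y = 0))
    (hval : weightedSumSquares K c x = a * weightedSumSquares K c y) :
    (a • weightedSumSquares K d).Equivalent (weightedSumSquares K d) := by
  have hK : ∀ v : Fin n → K, v ≠ 0 → weightedSumSquares K c v = 0 →
      (a • weightedSumSquares K d).Equivalent (weightedSumSquares K d) := fun v hv hv0 =>
    equivalent_smul_self_of_hasLagrangian_self ha d hd (h K ⟨v, hv, hv0⟩)
  set s := weightedSumSquares K c y with hs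
  by_cases hs0 : s = 0
  · rw [hs0, mul_zero] at hval
    by_cases hx : x = 0
    · exact hK y (fun hy => hxy ⟨hx, hy⟩) hs0
    · exact hK x hx hval
  have hy : y ≠ 0 := by
    rintro rfl
    exact hs0 (by simp [hs])
  obtain ⟨i₀, hi₀⟩ := Function.ne_iff.1 hy
  set β := ∑ i, c i * (x i * y i) with hβ
  simp only [weightedSumSquares_apply, smul_eq_mul] at hval hs
  have hline : ∀ (E : Type u) [Field E] [Algebra K E] (t : E),
      weightedSumSquares E (fun i => algebraMap K E (c i))
        (fun i => algebraMap K E (x i) + t * algebraMap K E (y i)) =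
      algebraMap K E (a * s) + 2 * t * algebraMap K E β + t ^ 2 * algebraMap K E s := by
    intro E _ _ t
    rw [← hval, hβ, hs]
    simp only [weightedSumSquares_apply, smul_eq_mul, map_sum, map_mul, Finset.mul_sum,
      ← Finset.sum_add_distrib]
    exact Finset.sum_congr rfl fun i _ => by ring
  by_cases hsq : ∃ r : K, r ^ 2 = β ^ 2 - a * s ^ 2
  · obtain ⟨r, hr⟩ := hsq
    set t := (r - β) / s with ht
    -- The root `t` gives a zero of the form unless `x = -t y`, in which case `a = t²`.
    by_cases hv : (fun i => x i + t * y i) = 0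
    · have hx : ∀ i, x i = -t * y i := fun i => by
        have := congrFun hv i
        simp only [Pi.zero_apply] at this
        linear_combination this
      have hat : a = t ^ 2 := by
        refine mul_right_cancel₀ hs0 ?_
        rw [← hval, hs, Finset.mul_sum]
        exact Finset.sum_congr rfl fun i _ => by rw [hx]; ring
      rw [hat] at ha ⊢
      exact equivalent_smul_self_sq _ (by rintro h0; simp [h0] at ha)
    · refine hK _ hv ?_
      have := hline K t
      simp only [Algebra.algebraMap_self, RingHom.id_apply] at this
      rw [this, ht]
      field_simp
      linear_combination hr
  · push Not at hsq
    obtain ⟨E, _, _, r, hr, hspan⟩ := exists_quadratic_extension hsq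
    have hs0' : algebraMap K E s ≠ 0 := by simpa using hs0
    set t := (r - algebraMap K E β) / algebraMap K E s with ht
    have hLag := h E ⟨fun i => algebraMap K E (x i) + t * algebraMap K E (y i), fun hv => ?_, ?_⟩
    -- The norm of `(β + r) / s`; up to sign, this element is a root of the form on the line.
    · have haeq : a = (β / s) ^ 2 - (β ^ 2 - a * s ^ 2) * (1 / s) ^ 2 := by
        field_simp
        ring
      rw [haeq] at ha ⊢
      exact equivalent_smul_self_of_hasLagrangian_quadratic hr hsq hspan ha d hd hLag
    -- If the vector vanished, its coordinate at `i₀`, where `y ≠ 0`, would put `r` in `K`.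
    · have h1 := congrFun hv i₀
      simp only [Pi.zero_apply] at h1 hi₀
      have hy0 : algebraMap K E (y i₀) ≠ 0 := by simpa using hi₀
      refine hsq (β - s * x i₀ / y i₀) ((algebraMap K E).injective ?_)
      rw [← hr]
      have : r = algebraMap K E (β - s * x i₀ / y i₀) := by
        rw [ht] at h1
        simp only [map_sub, map_div₀, map_mul]
        field_simp at h1 ⊢
        linear_combination h1
      rw [this, map_pow]
    · rw [hline, ht]
      field_simp
      rw [map_sub, map_mul, map_pow, map_pow] at hr
      simp only [map_mul]
      linear_combination hr

end QuadraticForm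

end

theorem mainTheorem2
    {F : Type*} [Field F] [Invertible (2 : F)]
    {V : Type*} [AddCommGroup V] [Module F V] [FiniteDimensional F V] [Nontrivial V]
    {W : Type*} [AddCommGroup W] [Module F W] [FiniteDimensional F W] [Nontrivial W]
    (p : QuadraticForm F V) (hp : p.Nondegenerate)
    (q : QuadraticForm F W) (hq : q.Nondegenerate)
    (h : QuadraticForm.IsHyperbolic
      (q.baseChange (QuadraticForm.FunctionField p hp)))
    (K : Type*) [Field K] [Algebra F K] [Invertible (2 : K)] :
    QuadraticForm.isotropyFactors (p.baseChange K) ⊆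
      QuadraticForm.similarityFactors (q.baseChange K) := by
  intro a ha
  obtain ⟨v, w, hvw, hval⟩ := QuadraticForm.exists_of_mem_isotropyFactors ha
  obtain ⟨c, ⟨e⟩⟩ := QuadraticForm.equivalent_weightedSumSquares_units_of_nondegenerate' p
    (QuadraticMap.nondegenerate_associated_iff.2 hp).1
  obtain ⟨d, hd⟩ := QuadraticForm.equivalent_weightedSumSquares_units_of_nondegenerate' q
    (QuadraticMap.nondegenerate_associated_iff.2 hq).1
  have e' : p.IsometryEquiv (QuadraticMap.weightedSumSquares F fun i => (c i : F)) := e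
  have hd' : q.Equivalent (QuadraticMap.weightedSumSquares F fun i => (d i : F)) := hd
  have hlag := h.hasLagrangian.of_equivalent
    (QuadraticForm.equivalent_baseChange_weightedSumSquares hd' (QuadraticForm.FunctionField p hp))
  obtain ⟨f⟩ := QuadraticForm.equivalent_baseChange_weightedSumSquares ⟨e'⟩ K
  refine QuadraticForm.equivalent_smul_self_of_equivalent
    (QuadraticForm.equivalent_baseChange_weightedSumSquares hd' K)
    (QuadraticForm.equivalent_smul_self_of_isotropic_imp (c := fun i => algebraMap F K (c i))
      (fun i => by simp) (fun E _ _ hE => ?_) a.ne_zero (x := f v) (y := f w) ?_ ?_)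
  -- Every extension of `K` is an extension of `F`, so the result on `F(p)` applies to `E` directly.
  · let _ : Algebra F E := ((algebraMap K E).comp (algebraMap F K)).toAlgebra
    exact QuadraticForm.HasLagrangian.of_functionField hp (fun i => (c i).ne_zero) e' hlag hE
  · rintro ⟨h1, h2⟩
    exact hvw ⟨(map_eq_zero_iff f f.injective).1 h1, (map_eq_zero_iff f f.injective).1 h2⟩
  · rw [f.map_app, f.map_app, hval]
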